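/- Let $G$ be a unimodular locally compact Hausdorff group with Haar measure $dg$, acting by measurable transformations on a probability space $(X,\nu)$; assume that the action map $G\times X\to X$, $(g,x)\mapsto gx$, is measurable (it is enough that it is measurable for the completion of $dg\otimes\nu$), and that the action preserves the class of $\nu$. For $g\in G$ let $$c(g,x)=\sqrt{\frac{d(g^{-1}_*\nu)}{d\nu}(x)},\qquad (\pi(g)\varphi)(x)=\varphi(g^{-1}x)\,c(g^{-1},x)\quad(\varphi\in L^2(X,\nu)),\qquad \Xi(g)=\langle\pi(g)\mathbf 1_X,\mathbf 1_X\rangle=\int_X c(g^{-1},x)\,d\nu(x).$$ Assume that the Koopman representation $\pi:G\to U(L^2(X,\nu))$ is strongly continuous and irreducible. Suppose that a subgroup $K<G$ acts transitively on $X$ and preserves $\nu$. Let $L:G\to[0,\infty)$ be a length function, that is, a Borel map with $L(e)=0$, $L(g^{-1})=L(g)$ and $L(gh)\le L(g)+L(h)$ for all $g,h\in G$, such that the balls $B_r=\{g\in G: L(g)\le r\}$ are relatively compact; assume that $L$ is $K$-bi-invariant, i.e. $L(kg)=L(gk)=L(g)$ for all $k\in K$, $g\in G$. Assume that for each integer $n_0>0$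 $$\lim_{n\to\infty}\frac{\int_{B_{n+n_0}\setminus B_{n-n_0}}\Xi(g)^2\,dg}{\int_{B_n}\Xi(g)^2\,dg}=0 .$$ Let $d\mu_n(g)=\dfrac{\mathbf 1_{B_n}(g)}{\int_{B_n}\Xi(h)^2\,dh}\,dg$ for $n\in\mathbb N$ (for the finitely many $n$ for which the denominator vanishes, put $\mu_n=0$). Then the operators $\int_G\pi(g)\otimes\pi(g^{-1})\,d\mu_n(g)$ on the Hilbert tensor product $L^2(X,\nu)\otimes L^2(X,\nu)$ are well defined as weak integrals and $$\lim_{n\to\infty}\int_G\pi(g)\otimes\pi(g^{-1})\,d\mu_n(g)=F$$ in the weak operator topology, where $F$ is the flip, $F(v\otimes w)=w\otimes v$. -/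

import Mathlib

open MeasureTheory Filter Topology TensorProduct

open scoped ENNReal InnerProductSpace

/-! ### The Koopman representation -/

section Koopman

set_option linter.unusedSectionVars false

/-- The action of `G` on `X` preserves the class of `ν`: for every `g`, the measures `g_* ν` and
`ν` have the same null sets. -/
def PreservesMeasureClass (G : Type*) {X : Type*} [Group G] [MulAction G X] [MeasurableSpace X]
    (ν : Measure X) : Prop :=
  ∀ g : G, ν.map (fun x => g • x) ≪ ν ∧ ν ≪ ν.map (fun x => g • x)

/-- `c(g, x)`, the square root of the Radon-Nikodym derivative `d(g⁻¹_* ν)/dν` at `x`. -/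
noncomputable def cocycle {G X : Type*} [Group G] [MulAction G X] [MeasurableSpace X]
    (ν : Measure X) (g : G) (x : X) : ℝ :=
  Real.sqrt (((ν.map (fun y => g⁻¹ • y)).rnDeriv ν x).toReal)

variable {G X : Type*} [Group G] [MulAction G X] [MeasurableSpace X] [MeasurableConstSMul G X]
  {ν : Measure X} [IsProbabilityMeasure ν]

/-- The function `x ↦ φ(g⁻¹ x) c(g⁻¹, x)`. -/
noncomputable def koopmanFun (ν : Measure X) (g : G) (φ : X → ℂ) (x : X) : ℂ :=
  φ (g⁻¹ • x) * (cocycle ν g⁻¹ x : ℂ)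

lemma measurable_cocycle (g : G) : Measurable (cocycle ν g) :=
  (Measure.measurable_rnDeriv _ _).ennreal_toReal.sqrt

lemma PreservesMeasureClass.quasi (hν : PreservesMeasureClass G ν) (g : G) :
    Measure.QuasiMeasurePreserving (fun x : X => g • x) ν ν :=
  ⟨measurable_const_smul g, (hν g).1⟩

lemma koopmanFun_congr (hν : PreservesMeasureClass G ν) (g : G) {φ ψ : X → ℂ} (h : φ =ᵐ[ν] ψ) :
    koopmanFun ν g φ =ᵐ[ν] koopmanFun ν g ψ := by
  filter_upwards [(hν.quasi g⁻¹).ae_eq_comp h] with x hx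
  have hx' : φ (g⁻¹ • x) = ψ (g⁻¹ • x) := hx
  simp [koopmanFun, hx']

lemma aestronglyMeasurable_koopmanFun (hν : PreservesMeasureClass G ν) (g : G) {φ : X → ℂ}
    (h : AEStronglyMeasurable φ ν) : AEStronglyMeasurable (koopmanFun ν g φ) ν :=
  (h.comp_quasiMeasurePreserving (hν.quasi g⁻¹)).mul
    (Complex.measurable_ofReal.comp (measurable_cocycle g⁻¹)).aestronglyMeasurable

lemma lintegral_koopmanFun (hν : PreservesMeasureClass G ν) (g : G) {φ : X → ℂ}
    (h : AEStronglyMeasurable φ ν) :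
    ∫⁻ x, ‖koopmanFun ν g φ x‖ₑ ^ (2 : ℝ) ∂ν = ∫⁻ x, ‖φ x‖ₑ ^ (2 : ℝ) ∂ν := by
  have hg : Measurable (fun x : X => g • x) := measurable_const_smul g
  have : IsProbabilityMeasure (ν.map (fun x : X => g • x)) :=
    Measure.isProbabilityMeasure_map hg.aemeasurable
  have hψ : AEMeasurable (fun x => ‖φ (g⁻¹ • x)‖ₑ ^ (2 : ℝ)) ν :=
    (h.comp_quasiMeasurePreserving (hν.quasi g⁻¹)).enorm.pow_const _
  have key : ∀ᵐ x ∂ν, ‖koopmanFun ν g φ x‖ₑ ^ (2 : ℝ)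
      = (ν.map (fun x : X => g • x)).rnDeriv ν x * ‖φ (g⁻¹ • x)‖ₑ ^ (2 : ℝ) := by
    filter_upwards [Measure.rnDeriv_lt_top (ν.map (fun x : X => g • x)) ν] with x hx
    have h0 : ‖((cocycle ν g⁻¹ x : ℝ) : ℂ)‖ₑ ^ (2 : ℝ)
        = (ν.map (fun x : X => g • x)).rnDeriv ν x := by
      rw [cocycle, ← ofReal_norm, Complex.norm_real, Real.norm_of_nonneg (Real.sqrt_nonneg _),
        ENNReal.ofReal_rpow_of_nonneg (Real.sqrt_nonneg _) (by norm_num), Real.rpow_two,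
        Real.sq_sqrt ENNReal.toReal_nonneg, inv_inv, ENNReal.ofReal_toReal hx.ne]
    rw [koopmanFun, enorm_mul, ENNReal.mul_rpow_of_nonneg _ _ (by norm_num), h0, mul_comm]
  rw [lintegral_congr_ae key, lintegral_rnDeriv_mul (hν g).1 hψ, lintegral_map' _ hg.aemeasurable]
  · simp
  · exact hψ.mono_ac (hν g).1

lemma eLpNorm_koopmanFun (hν : PreservesMeasureClass G ν) (g : G) {φ : X → ℂ}
    (h : AEStronglyMeasurable φ ν) : eLpNorm (koopmanFun ν g φ) 2 ν = eLpNorm φ 2 ν := by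
  rw [eLpNorm_eq_lintegral_rpow_enorm_toReal (by norm_num) (by norm_num),
    eLpNorm_eq_lintegral_rpow_enorm_toReal (by norm_num) (by norm_num)]
  simp only [ENNReal.toReal_ofNat]
  rw [lintegral_koopmanFun hν g h]

lemma memLp_koopmanFun (hν : PreservesMeasureClass G ν) (g : G) (φ : Lp ℂ 2 ν) :
    MemLp (koopmanFun ν g φ) 2 ν :=
  ⟨aestronglyMeasurable_koopmanFun hν g (Lp.aestronglyMeasurable φ), by
    rw [eLpNorm_koopmanFun hν g (Lp.aestronglyMeasurable φ)]; exact Lp.eLpNorm_lt_top φ⟩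

/-- The Koopman representation of `G` on `L²(X, ν)`:
`(π(g) φ)(x) = φ(g⁻¹ x) c(g⁻¹, x)`. -/
noncomputable def koopman (hν : PreservesMeasureClass G ν) (g : G) :
    Lp ℂ 2 ν →ₗᵢ[ℂ] Lp ℂ 2 ν where
  toFun φ := (memLp_koopmanFun hν g φ).toLp _
  map_add' φ ψ := by
    rw [← MemLp.toLp_add, MemLp.toLp_eq_toLp_iff]
    refine (koopmanFun_congr hν g (Lp.coeFn_add φ ψ)).trans (ae_of_all _ fun x => ?_)
    simp [koopmanFun, add_mul]
  map_smul' a φ := by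
    rw [RingHom.id_apply, ← MemLp.toLp_const_smul, MemLp.toLp_eq_toLp_iff]
    refine (koopmanFun_congr hν g (Lp.coeFn_smul a φ)).trans (ae_of_all _ fun x => ?_)
    simp [koopmanFun, mul_assoc]
  norm_map' φ := by
    change ‖(memLp_koopmanFun hν g φ).toLp _‖ = ‖φ‖
    rw [Lp.norm_toLp, eLpNorm_koopmanFun hν g (Lp.aestronglyMeasurable φ), Lp.norm_def]

lemma koopman_coeFn (hν : PreservesMeasureClass G ν) (g : G) (φ : Lp ℂ 2 ν) :
    (koopman hν g φ : X → ℂ) =ᵐ[ν] fun x => φ (g⁻¹ • x) * (cocycle ν g⁻¹ x : ℂ) :=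
  MemLp.coeFn_toLp (memLp_koopmanFun hν g φ)

end Koopman

/-- `Ξ(g) = ∫ c(g⁻¹, x) dν(x)`. -/
noncomputable def harishChandra {G X : Type*} [Group G] [MulAction G X] [MeasurableSpace X]
    (ν : Measure X) (g : G) : ℝ :=
  ∫ x, cocycle ν g⁻¹ x ∂ν

/-! ### Unitary representations, Hilbert tensor product and flip -/

/-- For every vector `v`, the orbit map `g ↦ π(g) v` is continuous. -/
def IsStronglyContinuous {G H : Type*} [TopologicalSpace G] [NormedAddCommGroup H]
    [InnerProductSpace ℂ H] (π : G → H →ₗᵢ[ℂ] H) : Prop :=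
  ∀ v : H, Continuous fun g => π g v

/-- `π` is (topologically) irreducible: the space is non-zero, and the only closed subspaces that
are invariant under all `π(g)` are `0` and the whole space. -/
def IsIrreducibleRep {G H : Type*} [NormedAddCommGroup H] [InnerProductSpace ℂ H]
    (π : G → H →ₗᵢ[ℂ] H) : Prop :=
  Nontrivial H ∧ ∀ V : Submodule ℂ H, IsClosed (V : Set H) →
    (∀ g, ∀ v ∈ V, π g v ∈ V) → V = ⊥ ∨ V = ⊤

/-- The Hilbert tensor product of `H` with itself: the completion of the algebraic tensor product
for the inner product `⟪a ⊗ b, c ⊗ d⟫ = ⟪a, c⟫ ⟪b, d⟫`. -/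
abbrev HilbertTensor (H : Type*) [NormedAddCommGroup H] [InnerProductSpace ℂ H] : Type _ :=
  UniformSpace.Completion (H ⊗[ℂ] H)

/-- The bounded operator `S ⊗ T` on the Hilbert tensor product. -/
noncomputable def tensorOp {H : Type*} [NormedAddCommGroup H] [InnerProductSpace ℂ H]
    (S T : H →L[ℂ] H) : HilbertTensor H →L[ℂ] HilbertTensor H :=
  (TensorProduct.mapL S T).completion

/-- The flip `F`, characterized by `F (v ⊗ w) = w ⊗ v`. -/
noncomputable def flipOp (H : Type*) [NormedAddCommGroup H] [InnerProductSpace ℂ H] :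
    HilbertTensor H →L[ℂ] HilbertTensor H :=
  ((TensorProduct.commIsometry ℂ H H).toLinearIsometry.toContinuousLinearMap).completion

lemma tensorOp_tmul {H : Type*} [NormedAddCommGroup H] [InnerProductSpace ℂ H]
    (S T : H →L[ℂ] H) (v w : H) :
    tensorOp S T ((v ⊗ₜ[ℂ] w : H ⊗[ℂ] H) : HilbertTensor H)
      = ((S v ⊗ₜ[ℂ] T w : H ⊗[ℂ] H) : HilbertTensor H) := by
  simp [tensorOp]

lemma flipOp_tmul {H : Type*} [NormedAddCommGroup H] [InnerProductSpace ℂ H] (v w : H) :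
    flipOp H ((v ⊗ₜ[ℂ] w : H ⊗[ℂ] H) : HilbertTensor H)
      = ((w ⊗ₜ[ℂ] v : H ⊗[ℂ] H) : HilbertTensor H) := by
  simp [flipOp]

/-- The bounded operator `M` is the (weak) operator integral `∫ T(g) dμ(g)`: for all vectors `α`
and `β` the coefficient `g ↦ ⟪β, T(g) α⟫` is integrable, with integral `⟪β, M α⟫`. These
conditions determine `M`. -/
def IsOperatorIntegral {G E : Type*} [MeasurableSpace G] [NormedAddCommGroup E]
    [InnerProductSpace ℂ E] (μ : Measure G) (T : G → E →L[ℂ] E) (M : E →L[ℂ] E) : Prop :=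
  ∀ α β : E, Integrable (fun g => ⟪β, T g α⟫_ℂ) μ ∧ ∫ g, ⟪β, T g α⟫_ℂ ∂μ = ⟪β, M α⟫_ℂ

/-! ### Length functions -/

/-- The ball `L⁻¹([0, r])` for a non-negative function `L`; it is empty when `r < 0`. -/
def lengthBall {G : Type*} (L : G → ℝ) (r : ℝ) : Set G := {g | L g ≤ r}

/-- A (proper, Borel) length function on a locally compact group. -/
structure IsLengthFunction {G : Type*} [Group G] [TopologicalSpace G] [MeasurableSpace G]
    (L : G → ℝ) : Prop where
  measurable : Measurable L
  nonneg : ∀ g, 0 ≤ L g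
  map_one : L 1 = 0
  map_inv : ∀ g, L g⁻¹ = L g
  map_mul_le : ∀ g h, L (g * h) ≤ L g + L h
  relativelyCompact : ∀ r : ℝ, IsCompact (closure (lengthBall L r))

/-- `L` is invariant under left and right translations by elements of `K`. -/
def IsBiInvariant {G : Type*} [Group G] (K : Subgroup G) (L : G → ℝ) : Prop :=
  ∀ k ∈ K, ∀ g, L (k * g) = L g ∧ L (g * k) = L g

/-- The measure `dμ_n(g) = 1_{B_n}(g) dg / ∫_{B_n} Ξ(g)² dg`, for the Haar measure `μ`. -/
noncomputable def ballMeasure {G X : Type*} [Group G] [MulAction G X] [MeasurableSpace G]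
    [MeasurableSpace X] (μ : Measure G) (ν : Measure X) (L : G → ℝ) (n : ℕ) : Measure G :=
  ENNReal.ofReal (∫ g in lengthBall L n, harishChandra ν g ^ 2 ∂μ)⁻¹ • μ.restrict (lengthBall L n)

/-! ### Schur's lemma -/

section Schur

variable {G H : Type*} [NormedAddCommGroup H] [InnerProductSpace ℂ H] [CompleteSpace H]
  {π : G → H →ₗᵢ[ℂ] H}

/-! Write `M n` for the normalised averages over the balls. The strategy is to bound `M n` in norm
uniformly, and then to show that every weak limit point of the sequence is forced to be the flip.

The bound is a Schur test. For step tensors the entries of `π(g) ⊗ π(g⁻¹)` are non-negative, since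
`π(g)` preserves positivity, and its row and column sums are products `⟨1, π(g) 1_A⟩ ⟨1, π(g⁻¹)
1_B⟩`. Integrated over a `K`-bi-invariant set `R`, such a product equals exactly `ν(A) ν(B) ∫_R Ξ²`
(`setIntegral_inner_oneVec_koopman_mul`): the integral is a form in two vectors, `K`-invariant in
each, and the `K`-invariant vectors are the constants (`eq_smul_oneVec_of_koopman_eq`). Hence `∫_R
|⟨β, (π(g) ⊗ π(g⁻¹)) α⟩| dg ≤ ‖α‖ ‖β‖ ∫_R Ξ²` (`setIntegral_norm_inner_le`). For balls this gives
`‖M n‖ ≤ 1`; for annuli, together with the growth hypothesis, it shows that translating the ball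
does not affect the limit.

Consequently a weak limit `S` satisfies `(π(h) ⊗ 1) S = S (1 ⊗ π(h))` and `(1 ⊗ π(h)) S = S (π(h) ⊗
1)`. By Schur's lemma applied in two pairs of variables (`IsIrreducibleRep.eq_flipOp`), `S` is a
multiple of the flip. The multiple is `1` because the coefficient of `M n` at `1 ⊗ 1` is exactly `1`
for large `n`. Weak compactness of bounded sets of operators then gives convergence. -/

lemma IsIrreducibleRep.exists_eq_smul_of_isSelfAdjoint (hirr : IsIrreducibleRep π)
    {A : H →L[ℂ] H} (hA : IsSelfAdjoint A) (hcomm : ∀ g v, A (π g v) = π g (A v)) :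
    ∃ c : ℝ, A = algebraMap ℝ (H →L[ℂ] H) c := by
  have hnt : Nontrivial H := hirr.1
  have hcfc : ∀ (f : ℝ → ℝ) (g : G) (v : H), cfc f A (π g v) = π g (cfc f A v) := by
    intro f g v
    have h1 : Commute A (π g).toContinuousLinearMap := by
      ext v; exact hcomm g v
    exact DFunLike.congr_fun (h1.cfc_real f).eq v
  obtain ⟨a, ha⟩ := ContinuousFunctionalCalculus.spectrum_nonempty (R := ℝ) A hA
  refine ⟨a, CFC.eq_algebraMap_of_spectrum_subset_singleton A a (fun b hb => ?_) hA⟩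
  by_contra hab
  have hab' : b ≠ a := hab
  wlog hlt : a < b generalizing a b
  · exact this b hb a ha (fun h => hab' h.symm) hab'.symm
      (lt_of_le_of_ne (not_lt.mp hlt) hab')
  -- Two spectral points `a < b` are separated by functions supported on either side of the
  -- midpoint. Their product vanishes, so the kernel of `f(A)` contains the range of `k(A)`; since
  -- neither operator is zero, this kernel is a proper non-zero closed invariant subspace.
  set m := (a + b) / 2
  set f : ℝ → ℝ := fun x => max (m - x) 0
  set k : ℝ → ℝ := fun x => max (x - m) 0
  have hf : Continuous f := by fun_prop
  have hk : Continuous k := by fun_prop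
  have hfk : cfc f A * cfc k A = 0 := by
    rw [← cfc_mul f k A hf.continuousOn hk.continuousOn]
    have : (fun x => f x * k x) = fun _ => 0 := by
      funext x
      rcases le_total m x with h | h
      · simp [f, max_eq_right (sub_nonpos.mpr h)]
      · simp [k, max_eq_right (sub_nonpos.mpr h)]
    rw [this, cfc_const_zero ℝ A]
  have hne : ∀ (q : ℝ → ℝ) (x : ℝ), Continuous q → x ∈ spectrum ℝ A → q x ≠ 0 →
      cfc q A ≠ 0 := by
    intro q x hq hx hqx h0
    have h1 : q x ∈ spectrum ℝ (cfc q A) := by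
      rw [cfc_map_spectrum q A hA hq.continuousOn]
      exact ⟨x, hx, rfl⟩
    rw [h0, spectrum.zero_eq] at h1
    exact hqx h1
  have hf0 : cfc f A ≠ 0 := hne f a hf ha (by
    have : 0 < m - a := by simp only [m]; linarith
    simp only [f]; exact (lt_max_of_lt_left this).ne')
  have hk0 : cfc k A ≠ 0 := hne k b hk hb (by
    have : 0 < b - m := by simp only [m]; linarith
    simp only [k]; exact (lt_max_of_lt_left this).ne')
  rcases hirr.2 (cfc f A).ker (cfc f A).isClosed_ker
    (fun g v hv => by
      have hv' : cfc f A v = 0 := hv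
      change cfc f A (π g v) = 0
      rw [hcfc, hv', map_zero]) with h | h
  · apply hk0
    ext v
    have : cfc k A v ∈ (cfc f A).ker := DFunLike.congr_fun hfk v
    rw [h] at this
    exact this
  · apply hf0
    ext v
    have : v ∈ (cfc f A).ker := by rw [h]; trivial
    exact this

/-- Schur's lemma. -/
lemma IsIrreducibleRep.exists_eq_smul [Group G] (hirr : IsIrreducibleRep π)
    (hinv : ∀ g v, π g (π g⁻¹ v) = v) {A : H →L[ℂ] H}
    (hcomm : ∀ g v, A (π g v) = π g (A v)) :
    ∃ c : ℂ, ∀ v, A v = c • v := by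
  have hcomm' : ∀ g v, star A (π g v) = π g (star A v) := by
    intro g v
    refine ext_inner_right ℂ fun w => ?_
    rw [ContinuousLinearMap.star_eq_adjoint, ContinuousLinearMap.adjoint_inner_left,
      ← hinv g (A w), (π g).inner_map_map, ← hcomm, ← ContinuousLinearMap.adjoint_inner_left,
      ← (π g).inner_map_map, hinv]
  have hr : ∀ g (r : ℝ) v, π g (r • v) = r • π g v := fun g r v => by
    rw [← Complex.coe_smul, map_smul, Complex.coe_smul]
  obtain ⟨a, ha⟩ := hirr.exists_eq_smul_of_isSelfAdjoint (A := (realPart A : H →L[ℂ] H))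
    (realPart A).2 (fun g v => by
      simp [realPart_apply_coe, hcomm, hcomm', hr, smul_add])
  obtain ⟨b, hb⟩ := hirr.exists_eq_smul_of_isSelfAdjoint (A := (imaginaryPart A : H →L[ℂ] H))
    (imaginaryPart A).2 (fun g v => by
      simp [imaginaryPart_apply_coe, hcomm, hcomm', hr, smul_sub])
  refine ⟨a + Complex.I * b, fun v => ?_⟩
  conv_lhs => rw [← realPart_add_I_smul_imaginaryPart A, ha, hb]
  simp [Algebra.algebraMap_eq_smul_one, add_smul, mul_smul]

end Schur

/-! ### Operators defined by sesquilinear forms -/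

section Forms

variable {E : Type*} [NormedAddCommGroup E] [InnerProductSpace ℂ E] [CompleteSpace E]

lemma exists_clm_inner_eq (b : E → E → ℂ) (C : ℝ)
    (hadd₁ : ∀ x x' y, b (x + x') y = b x y + b x' y)
    (hsmul₁ : ∀ (c : ℂ) x y, b (c • x) y = starRingEnd ℂ c * b x y)
    (hadd₂ : ∀ x y y', b x (y + y') = b x y + b x y')
    (hsmul₂ : ∀ (c : ℂ) x y, b x (c • y) = c * b x y)
    (hC : ∀ x y, ‖b x y‖ ≤ C * ‖x‖ * ‖y‖) :
    ∃ S : E →L[ℂ] E, ∀ x y, ⟪x, S y⟫_ℂ = b x y := by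
  let B : E →L⋆[ℂ] E →L[ℂ] ℂ :=
    (LinearMap.mk₂'ₛₗ (starRingEnd ℂ) (RingHom.id ℂ) b hadd₁ hsmul₁ hadd₂ hsmul₂).mkContinuous₂ C hC
  refine ⟨ContinuousLinearMap.adjoint (InnerProductSpace.continuousLinearMapOfBilin B),
    fun x y => ?_⟩
  rw [ContinuousLinearMap.adjoint_inner_right,
    InnerProductSpace.continuousLinearMapOfBilin_apply]
  rfl

/-- Norm-bounded sets of operators are relatively compact in the weak operator topology. -/
lemma exists_ultrafilter_limit {ι : Type*} (𝒰 : Ultrafilter ι) (M : ι → E →L[ℂ] E) (C : ℝ)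
    (hM : ∀ i, ‖M i‖ ≤ C) :
    ∃ S : E →L[ℂ] E, ∀ x y, Tendsto (fun i => ⟪x, M i y⟫_ℂ) 𝒰 (𝓝 ⟪x, S y⟫_ℂ) := by
  have hbd : ∀ x y i, ‖⟪x, M i y⟫_ℂ‖ ≤ C * ‖x‖ * ‖y‖ := by
    intro x y i
    calc ‖⟪x, M i y⟫_ℂ‖ ≤ ‖x‖ * ‖M i y‖ := norm_inner_le_norm _ _
      _ ≤ ‖x‖ * (C * ‖y‖) := by gcongr; exact (M i).le_of_opNorm_le (hM i) y
      _ = C * ‖x‖ * ‖y‖ := by ring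
  -- The coefficients stay in a compact disc, so they converge along the ultrafilter;
  -- sesquilinearity and the bound pass to the limit, and the limit form is represented by an
  -- operator.
  have hlim : ∀ x y, ∃ l : ℂ, Tendsto (fun i => ⟪x, M i y⟫_ℂ) 𝒰 (𝓝 l) := by
    intro x y
    have hmem : Metric.closedBall (0 : ℂ) (C * ‖x‖ * ‖y‖) ∈
        (𝒰.map (fun i => ⟪x, M i y⟫_ℂ) : Filter ℂ) :=
      Filter.mem_map.mpr (univ_mem' fun i => by simpa using hbd x y i)
    obtain ⟨l, -, hl⟩ := (isCompact_closedBall (0 : ℂ) (C * ‖x‖ * ‖y‖)).ultrafilter_le_nhds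
      (𝒰.map (fun i => ⟪x, M i y⟫_ℂ)) (le_principal_iff.mpr hmem)
    exact ⟨l, hl⟩
  choose b hb using hlim
  obtain ⟨S, hS⟩ := exists_clm_inner_eq b C
    (fun x x' y => tendsto_nhds_unique (hb _ _) (by
      simpa only [inner_add_left] using (hb x y).add (hb x' y)))
    (fun c x y => tendsto_nhds_unique (hb _ _) (by
      simpa only [inner_smul_left] using (hb x y).const_mul _))
    (fun x y y' => tendsto_nhds_unique (hb _ _) (by
      simpa only [map_add, inner_add_right] using (hb x y).add (hb x y')))
    (fun c x y => tendsto_nhds_unique (hb _ _) (by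
      simpa only [map_smul, inner_smul_right] using (hb x y).const_mul _))
    (fun x y => le_of_tendsto (hb x y).norm (Eventually.of_forall fun i => hbd x y i))
  exact ⟨S, fun x y => by rw [hS]; exact hb x y⟩

lemma exists_isOperatorIntegral {G : Type*} [MeasurableSpace G] (μ : Measure G)
    [IsFiniteMeasure μ] (T : G → E →L[ℂ] E)
    (hT : ∀ α β, AEStronglyMeasurable (fun g => ⟪β, T g α⟫_ℂ) μ) (C : ℝ) (hC : ∀ g, ‖T g‖ ≤ C) :
    ∃ M, IsOperatorIntegral μ T M := by
  have hbd : ∀ α β g, ‖⟪β, T g α⟫_ℂ‖ ≤ C * ‖β‖ * ‖α‖ := by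
    intro α β g
    calc ‖⟪β, T g α⟫_ℂ‖ ≤ ‖β‖ * ‖T g α‖ := norm_inner_le_norm _ _
      _ ≤ ‖β‖ * (C * ‖α‖) := by gcongr; exact (T g).le_of_opNorm_le (hC g) α
      _ = C * ‖β‖ * ‖α‖ := by ring
  have hint : ∀ α β, Integrable (fun g => ⟪β, T g α⟫_ℂ) μ := fun α β =>
    Integrable.of_bound (hT α β) _ (ae_of_all _ (hbd α β))
  obtain ⟨S, hS⟩ := exists_clm_inner_eq (fun β α => ∫ g, ⟪β, T g α⟫_ℂ ∂μ) (C * μ.real Set.univ)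
    (fun x x' y => by simp only [inner_add_left]; exact integral_add (hint _ _) (hint _ _))
    (fun c x y => by simp only [inner_smul_left]; exact integral_const_mul _ _)
    (fun x y y' => by
      simp only [map_add, inner_add_right]; exact integral_add (hint _ _) (hint _ _))
    (fun c x y => by simp only [map_smul, inner_smul_right]; exact integral_const_mul _ _)
    (fun x y => (norm_integral_le_of_norm_le_const (ae_of_all _ (hbd y x))).trans_eq (by ring))
  exact ⟨S, fun α β => ⟨hint α β, (hS β α).symm⟩⟩

end Forms

/-! ### The Hilbert tensor product -/

section Tensor

variable {H : Type*} [NormedAddCommGroup H] [InnerProductSpace ℂ H]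

/-- The elementary tensor `v ⊗ w` in the Hilbert tensor product. -/
noncomputable def HilbertTensor.tmul (v w : H) : HilbertTensor H := ((v ⊗ₜ[ℂ] w : H ⊗[ℂ] H) :)

lemma HilbertTensor.inner_tmul (v w v' w' : H) :
    ⟪HilbertTensor.tmul v w, HilbertTensor.tmul v' w'⟫_ℂ = ⟪v, v'⟫_ℂ * ⟪w, w'⟫_ℂ := by
  simp [HilbertTensor.tmul, UniformSpace.Completion.inner_coe]

lemma HilbertTensor.norm_tmul (v w : H) : ‖HilbertTensor.tmul v w‖ = ‖v‖ * ‖w‖ := by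
  simp [HilbertTensor.tmul]

/-- The map `v ↦ (w ↦ v ⊗ w)` as a bounded bilinear map. -/
noncomputable def HilbertTensor.tmulL : H →L[ℂ] H →L[ℂ] HilbertTensor H :=
  (LinearMap.mk₂ ℂ HilbertTensor.tmul
    (fun v v' w => by simp [HilbertTensor.tmul, add_tmul, UniformSpace.Completion.coe_add])
    (fun c v w => by simp [HilbertTensor.tmul, ← TensorProduct.smul_tmul'])
    (fun v w w' => by simp [HilbertTensor.tmul, tmul_add, UniformSpace.Completion.coe_add])
    (fun c v w => by simp [HilbertTensor.tmul])).mkContinuous₂ 1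
    (fun v w => by rw [one_mul]; exact (HilbertTensor.norm_tmul v w).le)

@[simp] lemma HilbertTensor.tmulL_apply (v w : H) :
    HilbertTensor.tmulL v w = HilbertTensor.tmul v w := rfl

lemma HilbertTensor.tensorOp_tmul' (S T : H →L[ℂ] H) (v w : H) :
    tensorOp S T (HilbertTensor.tmul v w) = HilbertTensor.tmul (S v) (T w) :=
  tensorOp_tmul S T v w

lemma HilbertTensor.flipOp_tmul' (v w : H) :
    flipOp H (HilbertTensor.tmul v w) = HilbertTensor.tmul w v :=
  flipOp_tmul v w

/-- Elementary tensors with factors from a set with dense span have dense span. -/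
lemma HilbertTensor.closed_induction {p : HilbertTensor H → Prop} (D : Set H)
    (hD : Dense (Submodule.span ℂ D : Set H))
    (hclosed : IsClosed {α | p α}) (hadd : ∀ α β, p α → p β → p (α + β))
    (hsmul : ∀ (c : ℂ) α, p α → p (c • α)) (h0 : p 0)
    (htmul : ∀ v ∈ D, ∀ w ∈ D, p (HilbertTensor.tmul v w)) (α : HilbertTensor H) : p α := by
  let V : Submodule ℂ (HilbertTensor H) :=
    { carrier := {α | p α}, add_mem' := fun ha hb => hadd _ _ ha hb, zero_mem' := h0,
      smul_mem' := fun c _ ha => hsmul c _ ha }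
  have h1 : ∀ v ∈ D, ∀ w, tmulL v w ∈ V := by
    intro v hv w
    have hle : Submodule.span ℂ D ≤ V.comap (tmulL v : H →ₗ[ℂ] HilbertTensor H) :=
      Submodule.span_le.mpr fun w hw => htmul v hv w hw
    have hcl : IsClosed {w | tmulL v w ∈ V} := hclosed.preimage (tmulL v).continuous
    exact (hcl.closure_subset_iff.mpr hle) (hD w)
  have h2 : ∀ v w, tmulL v w ∈ V := by
    intro v w
    have hle : Submodule.span ℂ D ≤ V.comap (tmulL.flip w : H →ₗ[ℂ] HilbertTensor H) :=
      Submodule.span_le.mpr fun v hv => h1 v hv w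
    have hcl : IsClosed {v | tmulL.flip w v ∈ V} := hclosed.preimage (tmulL.flip w).continuous
    exact (hcl.closure_subset_iff.mpr hle) (hD v)
  refine UniformSpace.Completion.induction_on α hclosed fun a => ?_
  induction a using TensorProduct.induction_on with
  | zero => rw [UniformSpace.Completion.coe_zero]; exact h0
  | tmul v w => exact h2 v w
  | add x y hx hy => rw [UniformSpace.Completion.coe_add]; exact hadd _ _ hx hy

lemma HilbertTensor.tmul_induction {p : HilbertTensor H → Prop}
    (hclosed : IsClosed {α | p α}) (hadd : ∀ α β, p α → p β → p (α + β))
    (hsmul : ∀ (c : ℂ) α, p α → p (c • α)) (h0 : p 0)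
    (htmul : ∀ v w, p (HilbertTensor.tmul v w)) (α : HilbertTensor H) : p α :=
  closed_induction Set.univ (by simp) hclosed hadd hsmul h0 (fun v _ w _ => htmul v w) α

lemma norm_tensorOp_isometry_apply (S T : H →ₗᵢ[ℂ] H) (α : HilbertTensor H) :
    ‖tensorOp S.toContinuousLinearMap T.toContinuousLinearMap α‖ = ‖α‖ := by
  refine UniformSpace.Completion.induction_on α
    (isClosed_eq (ContinuousLinearMap.continuous _).norm continuous_norm) fun a => ?_
  simp only [tensorOp, ContinuousLinearMap.completion_apply_coe, UniformSpace.Completion.norm_coe]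
  simp

lemma norm_tensorOp_isometry_le (S T : H →ₗᵢ[ℂ] H) :
    ‖tensorOp S.toContinuousLinearMap T.toContinuousLinearMap‖ ≤ 1 :=
  ContinuousLinearMap.opNorm_le_bound _ zero_le_one fun α => by
    rw [norm_tensorOp_isometry_apply, one_mul]

/-- The operators are isometric, so a limit of vectors has orbit maps converging uniformly in `g`.
Hence the vectors with continuous orbit map form a closed subspace, and elementary tensors belong to
it. -/
lemma continuous_tensorOp {G : Type*} [TopologicalSpace G] {π σ : G → H →ₗᵢ[ℂ] H}
    (hπ : IsStronglyContinuous π) (hσ : IsStronglyContinuous σ) (α : HilbertTensor H) :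
    Continuous fun g => tensorOp (π g).toContinuousLinearMap (σ g).toContinuousLinearMap α := by
  refine HilbertTensor.tmul_induction (p := fun α => Continuous fun g =>
    tensorOp (π g).toContinuousLinearMap (σ g).toContinuousLinearMap α) ?_ ?_ ?_ ?_ ?_ α
  · rw [← isSeqClosed_iff_isClosed]
    intro u a hu hua
    refine TendstoUniformly.continuous (p := atTop)
      (F := fun n g => tensorOp (π g).toContinuousLinearMap (σ g).toContinuousLinearMap (u n))
      ?_ (Frequently.of_forall hu)
    rw [Metric.tendstoUniformly_iff]
    intro ε hε
    filter_upwards [Metric.tendsto_nhds.mp hua ε hε] with n hn g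
    rw [dist_eq_norm, ← map_sub, norm_tensorOp_isometry_apply, ← dist_eq_norm, dist_comm]
    exact hn
  · intro a b ha hb
    simp only [map_add]; exact ha.add hb
  · intro c a ha
    simp only [map_smul]; exact ha.const_smul c
  · simpa only [map_zero] using continuous_const
  · intro v w
    simp only [HilbertTensor.tensorOp_tmul']
    exact (HilbertTensor.tmulL.continuous.comp (hπ v)).clm_apply (hσ w)

end Tensor

/-! ### Algebraic properties of the Koopman representation -/

section KoopmanRep

set_option linter.unusedSectionVars false

variable {G X : Type*} [Group G] [MulAction G X] [MeasurableSpace X] [MeasurableConstSMul G X]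
  {ν : Measure X} [IsProbabilityMeasure ν]

lemma isProbabilityMeasure_map_smul (ν : Measure X) [IsProbabilityMeasure ν] (g : G) :
    IsProbabilityMeasure (ν.map fun x => g • x) :=
  Measure.isProbabilityMeasure_map (measurable_const_smul g).aemeasurable

lemma cocycle_nonneg (g : G) (x : X) : 0 ≤ cocycle ν g x := Real.sqrt_nonneg _

/-- Chain rule `d(gh)_*ν/dν = d(gh)_*ν/dg_*ν · dg_*ν/dν`, where the first factor at `x` is
`dh_*ν/dν` at `g⁻¹x`. -/
lemma cocycle_mul (hν : PreservesMeasureClass G ν) (g h : G) :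
    (fun x => cocycle ν (g * h)⁻¹ x) =ᵐ[ν]
      fun x => cocycle ν h⁻¹ (g⁻¹ • x) * cocycle ν g⁻¹ x := by
  have := isProbabilityMeasure_map_smul ν g
  have := isProbabilityMeasure_map_smul ν h
  have := isProbabilityMeasure_map_smul ν (g * h)
  have hmap : ν.map (fun x => (g * h) • x) = (ν.map fun x => h • x).map (fun x => g • x) := by
    rw [Measure.map_map (measurable_const_smul g) (measurable_const_smul h)]
    simp only [Function.comp_def, mul_smul]
  have hac : ν.map (fun x => (g * h) • x) ≪ ν.map (fun x => g • x) := by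
    rw [hmap]
    exact (hν h).1.map (measurable_const_smul g)
  have h1 := Measure.rnDeriv_mul_rnDeriv (κ := ν) hac
  have h2 : (fun x => ((ν.map fun x => h • x).map (fun x => g • x)).rnDeriv
      (ν.map fun x => g • x) (g • x)) =ᵐ[ν] (ν.map fun x => h • x).rnDeriv ν :=
    (MeasurableEquiv.smul (α := X) g).measurableEmbedding.rnDeriv_map (ν.map fun x => h • x) ν
  have h3 := (hν.quasi g⁻¹).ae h2
  filter_upwards [h1, h3] with x hx1 hx3
  simp only [smul_inv_smul] at hx3
  rw [Pi.mul_apply, hmap] at hx1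
  simp only [cocycle, inv_inv]
  rw [hmap, ← hx1, hx3, ENNReal.toReal_mul, Real.sqrt_mul ENNReal.toReal_nonneg]

lemma koopman_mul (hν : PreservesMeasureClass G ν) (g h : G) (v : Lp ℂ 2 ν) :
    koopman hν (g * h) v = koopman hν g (koopman hν h v) := by
  refine Lp.ext ?_
  filter_upwards [koopman_coeFn hν (g * h) v, koopman_coeFn hν g (koopman hν h v),
    (hν.quasi g⁻¹).ae (koopman_coeFn hν h v), cocycle_mul hν g h] with x h1 h2 h3 h4
  rw [h1, h2, h3, h4]
  simp only [mul_inv_rev, mul_smul, Complex.ofReal_mul]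
  ring

lemma cocycle_ae_eq_one {k : G} (hk : MeasurePreserving (fun x : X => k • x) ν ν) :
    ∀ᵐ x ∂ν, cocycle ν k⁻¹ x = 1 := by
  filter_upwards [ν.rnDeriv_self] with x hx
  simp [cocycle, hk.map_eq, hx]

lemma koopman_coeFn_of_measurePreserving (hν : PreservesMeasureClass G ν) {k : G}
    (hk : MeasurePreserving (fun x : X => k • x) ν ν) (v : Lp ℂ 2 ν) :
    (koopman hν k v : X → ℂ) =ᵐ[ν] fun x => v (k⁻¹ • x) := by
  filter_upwards [koopman_coeFn hν k v, cocycle_ae_eq_one hk] with x h1 h2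
  simp [h1, h2]

lemma koopman_one (hν : PreservesMeasureClass G ν) (v : Lp ℂ 2 ν) :
    koopman hν (1 : G) v = v := by
  refine Lp.ext ((koopman_coeFn_of_measurePreserving hν ?_ v).trans (ae_of_all _ fun x => ?_))
  · simp only [one_smul]; exact MeasurePreserving.id ν
  · simp

lemma koopman_apply_inv (hν : PreservesMeasureClass G ν) (g : G) (v : Lp ℂ 2 ν) :
    koopman hν g (koopman hν g⁻¹ v) = v := by
  rw [← koopman_mul, mul_inv_cancel, koopman_one]

lemma inner_koopman_left (hν : PreservesMeasureClass G ν) (g : G) (v w : Lp ℂ 2 ν) :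
    ⟪koopman hν g v, w⟫_ℂ = ⟪v, koopman hν g⁻¹ w⟫_ℂ := by
  rw [← (koopman hν g).inner_map_map v, koopman_apply_inv]

/-! ### Indicator functions -/

/-- The indicator function of a measurable set, as a vector of `L²(X, ν)`. -/
noncomputable def indVec (ν : Measure X) [IsProbabilityMeasure ν] {A : Set X}
    (hA : MeasurableSet A) : Lp ℂ 2 ν :=
  indicatorConstLp 2 hA (measure_ne_top ν A) 1

/-- The constant function `1`, as a vector of `L²(X, ν)`. -/
noncomputable def oneVec (ν : Measure X) [IsProbabilityMeasure ν] : Lp ℂ 2 ν :=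
  indVec ν MeasurableSet.univ

lemma indVec_coeFn {A : Set X} (hA : MeasurableSet A) :
    (indVec ν hA : X → ℂ) =ᵐ[ν] A.indicator fun _ => 1 :=
  indicatorConstLp_coeFn

lemma oneVec_coeFn : (oneVec ν : X → ℂ) =ᵐ[ν] fun _ => 1 := by
  simpa only [oneVec, Set.indicator_univ] using indVec_coeFn (ν := ν) MeasurableSet.univ

lemma koopman_indVec_coeFn (hν : PreservesMeasureClass G ν) (g : G) {A : Set X}
    (hA : MeasurableSet A) :
    (koopman hν g (indVec ν hA) : X → ℂ) =ᵐ[ν]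
      fun x => ((A.indicator (fun _ => 1) (g⁻¹ • x) * cocycle ν g⁻¹ x : ℝ) : ℂ) := by
  filter_upwards [koopman_coeFn hν g (indVec ν hA), (hν.quasi g⁻¹).ae (indVec_coeFn hA)]
    with x h1 h2
  rw [h1, h2]
  by_cases h : g⁻¹ • x ∈ A <;> simp [h]

lemma koopman_oneVec_coeFn (hν : PreservesMeasureClass G ν) (g : G) :
    (koopman hν g (oneVec ν) : X → ℂ) =ᵐ[ν] fun x => (cocycle ν g⁻¹ x : ℂ) := by
  filter_upwards [koopman_indVec_coeFn hν g MeasurableSet.univ] with x h1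
  rw [oneVec, h1]
  simp

/-- `π(g)` preserves non-negative functions. This positivity is what makes the Schur test possible
later. -/
lemma exists_inner_indVec_koopman_eq (hν : PreservesMeasureClass G ν) (g : G) {A B : Set X}
    (hA : MeasurableSet A) (hB : MeasurableSet B) :
    ∃ r : ℝ, 0 ≤ r ∧ ⟪indVec ν hA, koopman hν g (indVec ν hB)⟫_ℂ = r := by
  refine ⟨∫ x in A, B.indicator (fun _ => 1) (g⁻¹ • x) * cocycle ν g⁻¹ x ∂ν,
    integral_nonneg fun x => mul_nonneg (Set.indicator_nonneg (fun _ _ => zero_le_one) _)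
      (cocycle_nonneg _ _), ?_⟩
  rw [indVec, L2.inner_indicatorConstLp_one, ← integral_complex_ofReal]
  exact integral_congr_ae (ae_restrict_of_ae (koopman_indVec_coeFn hν g hB))

/-- The (non-negative) matrix coefficient `⟨1_A, π(g) 1_B⟩`, as a real number. -/
noncomputable def indCoeff (hν : PreservesMeasureClass G ν) (g : G) {A B : Set X}
    (hA : MeasurableSet A) (hB : MeasurableSet B) : ℝ :=
  (⟪indVec ν hA, koopman hν g (indVec ν hB)⟫_ℂ).re

lemma ofReal_indCoeff (hν : PreservesMeasureClass G ν) (g : G) {A B : Set X}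
    (hA : MeasurableSet A) (hB : MeasurableSet B) :
    (indCoeff hν g hA hB : ℂ) = ⟪indVec ν hA, koopman hν g (indVec ν hB)⟫_ℂ := by
  obtain ⟨r, -, hr⟩ := exists_inner_indVec_koopman_eq hν g hA hB
  rw [indCoeff, hr, Complex.ofReal_re]

lemma indCoeff_nonneg (hν : PreservesMeasureClass G ν) (g : G) {A B : Set X}
    (hA : MeasurableSet A) (hB : MeasurableSet B) : 0 ≤ indCoeff hν g hA hB := by
  obtain ⟨r, hr0, hr⟩ := exists_inner_indVec_koopman_eq hν g hA hB
  rwa [indCoeff, hr, Complex.ofReal_re]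

lemma indCoeff_inv (hν : PreservesMeasureClass G ν) (g : G) {A B : Set X}
    (hA : MeasurableSet A) (hB : MeasurableSet B) :
    indCoeff hν g⁻¹ hA hB = indCoeff hν g hB hA := by
  rw [indCoeff, indCoeff, ← inner_koopman_left, ← inner_conj_symm, Complex.conj_re]

lemma harishChandra_eq_inner (hν : PreservesMeasureClass G ν) (g : G) :
    (harishChandra ν g : ℂ) = ⟪oneVec ν, koopman hν g (oneVec ν)⟫_ℂ := by
  rw [oneVec, indVec, L2.inner_indicatorConstLp_one, harishChandra, ← integral_complex_ofReal,
    setIntegral_univ]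
  exact integral_congr_ae (koopman_oneVec_coeFn hν g).symm

lemma harishChandra_eq_indCoeff (hν : PreservesMeasureClass G ν) (g : G) :
    harishChandra ν g = indCoeff hν g MeasurableSet.univ MeasurableSet.univ := by
  rw [indCoeff, ← oneVec, ← harishChandra_eq_inner, Complex.ofReal_re]

lemma harishChandra_inv (hν : PreservesMeasureClass G ν) (g : G) :
    harishChandra ν g⁻¹ = harishChandra ν g := by
  rw [harishChandra_eq_indCoeff hν, harishChandra_eq_indCoeff hν, indCoeff_inv]

lemma norm_oneVec : ‖oneVec ν‖ = 1 := by
  rw [oneVec, indVec, norm_indicatorConstLp (by norm_num) (by norm_num)]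
  simp

lemma inner_oneVec_oneVec : ⟪oneVec ν, oneVec ν⟫_ℂ = 1 := by
  rw [inner_self_eq_norm_sq_to_K, norm_oneVec]; simp

/-- `π(g) 1` is the non-negative function `c(g⁻¹, ·)` and has norm `1`, so its integral cannot
vanish. -/
lemma harishChandra_pos (hν : PreservesMeasureClass G ν) (g : G) : 0 < harishChandra ν g := by
  have hint : Integrable (fun x => cocycle ν g⁻¹ x) ν := by
    have h1 : MemLp (fun x => (cocycle ν g⁻¹ x : ℂ)) 2 ν :=
      (memLp_congr_ae (koopman_oneVec_coeFn hν g)).mp (Lp.memLp _)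
    simpa using (h1.integrable (by norm_num)).re
  refine lt_of_le_of_ne (integral_nonneg fun x => cocycle_nonneg _ _) fun h0 => ?_
  have h2 := (integral_eq_zero_iff_of_nonneg (fun x => cocycle_nonneg _ _) hint).mp h0.symm
  have h3 : koopman hν g (oneVec ν) = 0 := by
    refine Lp.ext ?_
    filter_upwards [koopman_oneVec_coeFn hν g, h2, Lp.coeFn_zero ℂ 2 ν] with x hx1 hx2 hx3
    rw [hx1, hx2, hx3]; simp
  have h4 : ‖koopman hν g (oneVec ν)‖ = 1 := by rw [LinearIsometry.norm_map, norm_oneVec]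
  rw [h3, norm_zero] at h4
  exact zero_ne_one h4

lemma harishChandra_le_one (hν : PreservesMeasureClass G ν) (g : G) : harishChandra ν g ≤ 1 := by
  rw [harishChandra_eq_indCoeff hν, indCoeff]
  refine (Complex.re_le_norm _).trans ((norm_inner_le_norm _ _).trans ?_)
  rw [LinearIsometry.norm_map, ← oneVec, norm_oneVec, one_mul]

lemma continuous_harishChandra [TopologicalSpace G] (hν : PreservesMeasureClass G ν)
    (hcont : IsStronglyContinuous (koopman (G := G) hν)) :
    Continuous fun g : G => harishChandra ν g := by
  simp only [harishChandra_eq_indCoeff hν, indCoeff]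
  exact Complex.continuous_re.comp (continuous_const.inner (hcont _))

lemma dense_span_indVec (ν : Measure X) [IsProbabilityMeasure ν] :
    Dense (Submodule.span ℂ {v : Lp ℂ 2 ν | ∃ (A : Set X) (hA : MeasurableSet A),
      v = indVec ν hA} : Set (Lp ℂ 2 ν)) := by
  set V := Submodule.span ℂ {v : Lp ℂ 2 ν | ∃ (A : Set X) (hA : MeasurableSet A), v = indVec ν hA}
  intro v
  refine Lp.induction (p := 2) (by norm_num) (motive := fun v => v ∈ closure (V : Set (Lp ℂ 2 ν)))
    ?_ ?_ ?_ v
  · intro c A hA hνA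
    refine subset_closure ?_
    have : (Lp.simpleFunc.indicatorConst 2 hA hνA.ne c : Lp ℂ 2 ν) = c • indVec ν hA := by
      rw [Lp.simpleFunc.coe_indicatorConst]
      refine Lp.ext ?_
      filter_upwards [indicatorConstLp_coeFn (p := 2) (hs := hA) (hμs := hνA.ne) (c := c),
        indVec_coeFn hA, Lp.coeFn_smul c (indVec ν hA)] with x h1 h2 h3
      rw [h1, h3, Pi.smul_apply, h2]
      by_cases h : x ∈ A <;> simp [h]
    rw [this]
    exact V.smul_mem _ (Submodule.subset_span ⟨A, hA, rfl⟩)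
  · intro f g hf hg _ h1 h2
    exact V.topologicalClosure.add_mem h1 h2
  · exact isClosed_closure

end KoopmanRep

/-! ### Ergodicity of the subgroup `K` -/

lemma integral_norm_le_norm_Lp_two {X : Type*} [MeasurableSpace X] {ν : Measure X}
    [IsProbabilityMeasure ν] (v : Lp ℂ 2 ν) : ∫ x, ‖v x‖ ∂ν ≤ ‖v‖ := by
  have h1 : Integrable v ν := (Lp.memLp v).integrable (by norm_num)
  rw [integral_norm_eq_lintegral_enorm h1.aestronglyMeasurable, Lp.norm_def,
    ← eLpNorm_one_eq_lintegral_enorm]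
  exact ENNReal.toReal_mono (Lp.eLpNorm_ne_top v)
    (eLpNorm_le_eLpNorm_of_exponent_le (by norm_num) h1.aestronglyMeasurable)

/-- The mean `m` of `f` is nearly as good as any constant `c`, because `|c - m| ≤ ∫ |f - c|`; thus
`∫ |f - m| ≤ 2 ∫ |f - c|`. -/
lemma ae_eq_const_of_forall_integral_le {X : Type*} [MeasurableSpace X] {ν : Measure X}
    [IsProbabilityMeasure ν] {f : X → ℝ} (hf : Integrable f ν)
    (h : ∀ ε > 0, ∃ c : ℝ, ∫ x, |f x - c| ∂ν ≤ ε) : ∃ c : ℝ, f =ᵐ[ν] fun _ => c := by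
  set m := ∫ x, f x ∂ν with hm
  have h0 : ∫ x, |f x - m| ∂ν ≤ 0 := by
    refine le_of_forall_pos_le_add fun ε hε => ?_
    obtain ⟨c, hc⟩ := h (ε / 2) (half_pos hε)
    have hint : Integrable (fun x => |f x - c|) ν := (hf.sub (integrable_const c)).abs
    have h1 : |c - m| ≤ ε / 2 := by
      have : c - m = -∫ x, (f x - c) ∂ν := by
        rw [integral_sub hf (integrable_const c)]; simp [hm]
      rw [this, abs_neg]
      exact (abs_integral_le_integral_abs).trans hc
    calc ∫ x, |f x - m| ∂ν ≤ ∫ x, (|f x - c| + |c - m|) ∂ν :=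
          integral_mono (hf.sub (integrable_const m)).abs (hint.add (integrable_const _))
            fun x => abs_sub_le _ _ _
      _ = ∫ x, |f x - c| ∂ν + |c - m| := by
          rw [integral_add hint (integrable_const _)]; simp
      _ ≤ 0 + ε := by linarith
  refine ⟨m, ?_⟩
  have h1 := (integral_eq_zero_iff_of_nonneg (fun x => abs_nonneg (f x - m))
    (hf.sub (integrable_const m)).abs).mp (le_antisymm h0 (integral_nonneg fun x => abs_nonneg _))
  filter_upwards [h1] with x hx
  exact sub_eq_zero.mp (abs_eq_zero.mp hx)

/-! ### Balls of a length function: finite measure and exhaustion of the group. -/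

section LengthBall

set_option linter.unusedSectionVars false

variable {G : Type*} [Group G] [TopologicalSpace G] [MeasurableSpace G] {L : G → ℝ}

lemma IsLengthFunction.measurableSet_lengthBall (hL : IsLengthFunction L) (r : ℝ) :
    MeasurableSet (lengthBall L r) :=
  measurableSet_le hL.measurable measurable_const

lemma IsLengthFunction.measure_lengthBall_lt_top (hL : IsLengthFunction L) (μ : Measure G)
    [IsFiniteMeasureOnCompacts μ] (r : ℝ) : μ (lengthBall L r) < ∞ :=
  (measure_mono subset_closure).trans_lt (hL.relativelyCompact r).measure_lt_top

lemma iUnion_lengthBall (L : G → ℝ) : ⋃ n : ℕ, lengthBall L n = Set.univ :=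
  Set.iUnion_eq_univ_iff.mpr fun g => exists_nat_ge (L g)

lemma IsLengthFunction.sigmaFinite (hL : IsLengthFunction L) (μ : Measure G)
    [IsFiniteMeasureOnCompacts μ] : SigmaFinite μ :=
  ⟨⟨⟨fun n : ℕ => lengthBall L n, fun _ => trivial, fun n => hL.measure_lengthBall_lt_top μ n,
    iUnion_lengthBall L⟩⟩⟩

lemma exists_measure_inter_lengthBall_pos (L : G → ℝ) (μ : Measure G) {U : Set G}
    (hU : μ U ≠ 0) : ∃ n : ℕ, μ (U ∩ lengthBall L n) ≠ 0 := by
  by_contra! h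
  apply hU
  rw [← Set.inter_univ U, ← iUnion_lengthBall L, Set.inter_iUnion]
  exact measure_iUnion_null h

end LengthBall

/-! ### `K`-bi-invariant sets and translation of integrals over them. -/

section BiInvariant

variable {G : Type*} [Group G] {K : Subgroup G} {R : Set G}

/-- The set `R` satisfies `K R K = R`. -/
def IsBiInvariantSet (K : Subgroup G) (R : Set G) : Prop :=
  ∀ k ∈ K, ∀ g, (k * g ∈ R ↔ g ∈ R) ∧ (g * k ∈ R ↔ g ∈ R)

lemma IsBiInvariant.isBiInvariantSet {L : G → ℝ} (hLK : IsBiInvariant K L) (s : Set ℝ) :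
    IsBiInvariantSet K (L ⁻¹' s) := fun k hk g => by
  simp only [Set.mem_preimage, (hLK k hk g).1, (hLK k hk g).2, and_self]

variable [MeasurableSpace G] [MeasurableMul G] (μ : Measure G)
  {E : Type*} [NormedAddCommGroup E] [NormedSpace ℝ E]

lemma setIntegral_mul_right_eq [μ.IsMulRightInvariant] {k : G} (hk : ∀ g, g * k ∈ R ↔ g ∈ R)
    (f : G → E) : ∫ g in R, f (g * k) ∂μ = ∫ g in R, f g ∂μ := by
  have h := (measurePreserving_mul_right μ k).setIntegral_preimage_emb
    (measurableEmbedding_mulRight k) f R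
  rwa [show (fun g => g * k) ⁻¹' R = R from Set.ext hk] at h

lemma setIntegral_mul_left_eq [μ.IsMulLeftInvariant] {k : G} (hk : ∀ g, k * g ∈ R ↔ g ∈ R)
    (f : G → E) : ∫ g in R, f (k * g) ∂μ = ∫ g in R, f g ∂μ := by
  have h := (measurePreserving_mul_left μ k).setIntegral_preimage_emb
    (measurableEmbedding_mulLeft k) f R
  rwa [show (fun g => k * g) ⁻¹' R = R from Set.ext hk] at h

end BiInvariant

/-! ### `K`-invariant vectors are constant. -/

section Ergodic

set_option linter.unusedSectionVars false

variable {G : Type*} [Group G] [TopologicalSpace G] [IsTopologicalGroup G]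
  [MeasurableSpace G] [BorelSpace G]
  {μ : Measure G} {X : Type*} [MeasurableSpace X] {ν : Measure X} [IsProbabilityMeasure ν]
  [MulAction G X] [MeasurableConstSMul G X] {K : Subgroup G} {L : G → ℝ}

lemma koopman_oneVec_of_measurePreserving (hν : PreservesMeasureClass G ν) {k : G}
    (hk : MeasurePreserving (fun x : X => k • x) ν ν) :
    koopman hν k (oneVec ν) = oneVec ν := by
  refine Lp.ext ?_
  filter_upwards [koopman_oneVec_coeFn hν k, cocycle_ae_eq_one hk, oneVec_coeFn (ν := ν)]
    with x h1 h2 h3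
  rw [h1, h2, h3, Complex.ofReal_one]

/-- Strong continuity controls `1_A(gx) c(g, x)`, not `1_A(gx)`. The second norm, which compares
`c(g, ·) = π(g⁻¹) 1` with `1`, pays for dropping the cocycle. -/
lemma integral_abs_indicator_smul_sub_le (hν : PreservesMeasureClass G ν) {A : Set X}
    (hA : MeasurableSet A) (g : G) :
    ∫ x, |A.indicator (fun _ => (1 : ℝ)) x - A.indicator (fun _ => 1) (g • x)| ∂ν
      ≤ ‖koopman hν g⁻¹ (indVec ν hA) - indVec ν hA‖ + ‖koopman hν g⁻¹ (oneVec ν) - oneVec ν‖ := by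
  set v := koopman hν g⁻¹ (indVec ν hA) - indVec ν hA with hv
  set w := koopman hν g⁻¹ (oneVec ν) - oneVec ν with hw
  have hvi : Integrable v ν := (Lp.memLp v).integrable (by norm_num)
  have hwi : Integrable w ν := (Lp.memLp w).integrable (by norm_num)
  have hle : ∀ᵐ x ∂ν, |A.indicator (fun _ => (1 : ℝ)) x - A.indicator (fun _ => 1) (g • x)|
      ≤ ‖v x‖ + ‖w x‖ := by
    filter_upwards [koopman_indVec_coeFn hν g⁻¹ hA, koopman_oneVec_coeFn hν g⁻¹,
      indVec_coeFn (ν := ν) hA, oneVec_coeFn (ν := ν),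
      Lp.coeFn_sub (koopman hν g⁻¹ (indVec ν hA)) (indVec ν hA),
      Lp.coeFn_sub (koopman hν g⁻¹ (oneVec ν)) (oneVec ν)] with x h1 h2 h3 h4 h5 h6
    rw [← hv] at h5
    rw [← hw] at h6
    rw [h5, h6, Pi.sub_apply, Pi.sub_apply, h1, h2, h3, h4, inv_inv]
    -- To be used with `a = 1_A(gx)`, `b = 1_A(x)` and `c = c(g, x)`.
    have e1 : ∀ c a b : ℝ, a = 0 ∨ a = 1 →
        |b - a| ≤ ‖((a * c : ℝ) : ℂ) - (b : ℂ)‖ + ‖(c : ℂ) - 1‖ := by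
      intro c a b ha
      rw [← Complex.ofReal_sub, ← Complex.ofReal_one, ← Complex.ofReal_sub, Complex.norm_real,
        Complex.norm_real, Real.norm_eq_abs, Real.norm_eq_abs]
      rcases ha with rfl | rfl
      · rw [zero_mul, zero_sub, abs_neg, sub_zero]
        exact le_add_of_nonneg_right (abs_nonneg _)
      · rw [one_mul, abs_sub_comm c b]
        exact abs_sub_le b c 1
    have e2 : ((A.indicator (fun _ => (1 : ℝ)) x : ℝ) : ℂ) = A.indicator (fun _ => (1 : ℂ)) x := by
      by_cases h : x ∈ A <;> simp [h]
    rw [← e2]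
    refine e1 _ _ _ ?_
    by_cases h : g • x ∈ A <;> simp [h]
  calc _ ≤ ∫ x, (‖v x‖ + ‖w x‖) ∂ν :=
        integral_mono_of_nonneg (ae_of_all _ fun x => abs_nonneg _) (hvi.norm.add hwi.norm) hle
    _ = ∫ x, ‖v x‖ ∂ν + ∫ x, ‖w x‖ ∂ν := integral_add hvi.norm hwi.norm
    _ ≤ _ := add_le_add (integral_norm_le_norm_Lp_two v) (integral_norm_le_norm_Lp_two w)

/-- A function on `G × X` of the form `(g, x) ↦ f (g x)` can be averaged over a set `E ⊆ G` with
`E K = E`. The average is everywhere `K`-invariant, hence constant if `K` is transitive. -/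
lemma exists_integral_abs_sub_const_le [SigmaFinite μ] [μ.IsMulRightInvariant]
    (hact : NullMeasurable (fun p : G × X => p.1 • p.2) (μ.prod ν))
    (hKtrans : MulAction.IsPretransitive K X) {A : Set X} (hA : MeasurableSet A)
    {E : Set G} (hE0 : μ E ≠ 0) (hEtop : μ E ≠ ∞)
    (hEK : ∀ k ∈ K, ∀ g, g * k ∈ E ↔ g ∈ E) (ε : ℝ) (hEm : MeasurableSet E)
    (hε : ∀ g ∈ E,
      ∫ x, |A.indicator (fun _ => (1 : ℝ)) x - A.indicator (fun _ => 1) (g • x)| ∂ν ≤ ε) :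
    ∃ c : ℝ, ∫ x, |A.indicator (fun _ => (1 : ℝ)) x - c| ∂ν ≤ ε := by
  set f : X → ℝ := A.indicator fun _ => 1 with hf
  have hfm : Measurable f := measurable_const.indicator hA
  have hf1 : ∀ x, |f x| ≤ 1 := fun x => by
    by_cases h : x ∈ A <;> simp [hf, h]
  obtain ⟨x₀⟩ : Nonempty X := nonempty_of_isProbabilityMeasure ν
  have : Fact (μ E < ∞) := ⟨hEtop.lt_top⟩
  set m := μ.real E with hm
  have hm0 : 0 < m := ENNReal.toReal_pos hE0 hEtop
  -- Replacing `x₀` by `k x₀` amounts to translating `E` on the right by `k`. The equality holds at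
  -- every point, with no exceptional null set depending on `k`, so transitivity of the possibly
  -- uncountable `K` applies.
  have hconst : ∀ x, ∫ g in E, f (g • x) ∂μ = ∫ g in E, f (g • x₀) ∂μ := by
    intro x
    obtain ⟨⟨k, hk⟩, rfl⟩ := hKtrans.exists_smul_eq x₀ x
    have := setIntegral_mul_right_eq μ (hEK k hk) (fun g => f (g • x₀))
    simp only [mul_smul] at this
    exact this
  have hmeas : AEStronglyMeasurable (fun p : G × X => f (p.1 • p.2)) ((μ.restrict E).prod ν) := by
    have h1 : NullMeasurable (fun p : G × X => f (p.1 • p.2)) (μ.prod ν) :=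
      hfm.comp_nullMeasurable hact
    have h2 : (μ.restrict E).prod ν = (μ.prod ν).restrict (E ×ˢ Set.univ) := by
      rw [← Measure.prod_restrict, Measure.restrict_univ]
    rw [h2]
    exact h1.aemeasurable.aestronglyMeasurable.restrict
  have hint : Integrable (fun p : G × X => f (p.1 • p.2)) ((μ.restrict E).prod ν) :=
    Integrable.of_bound hmeas 1 (ae_of_all _ fun p => hf1 _)
  have hint1 : Integrable (fun p : G × X => f p.2) ((μ.restrict E).prod ν) :=
    Integrable.of_bound (hfm.comp measurable_snd).aestronglyMeasurable 1 (ae_of_all _ fun p => hf1 _)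
  have hint2 : Integrable (fun p : G × X => |f p.2 - f (p.1 • p.2)|) ((μ.restrict E).prod ν) :=
    (hint1.sub hint).abs
  refine ⟨m⁻¹ * ∫ g in E, f (g • x₀) ∂μ, ?_⟩
  have hle : ∀ᵐ x ∂ν, |f x - m⁻¹ * ∫ g in E, f (g • x₀) ∂μ|
      ≤ m⁻¹ * ∫ g in E, |f x - f (g • x)| ∂μ := by
    filter_upwards [hint.prod_left_ae] with x hx
    have e1 : f x - m⁻¹ * ∫ g in E, f (g • x₀) ∂μ = m⁻¹ * ∫ g in E, (f x - f (g • x)) ∂μ := by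
      rw [integral_sub (integrable_const _) hx, hconst x, setIntegral_const, smul_eq_mul, mul_sub,
        ← hm, inv_mul_cancel_left₀ hm0.ne']
    rw [e1, abs_mul, abs_of_pos (inv_pos.mpr hm0)]
    exact mul_le_mul_of_nonneg_left abs_integral_le_integral_abs (inv_pos.mpr hm0).le
  -- Fubini: the `L¹` distance from `f` to its average over `E` is at most the average over `E` of
  -- the distances from `f` to its translates.
  calc ∫ x, |f x - m⁻¹ * ∫ g in E, f (g • x₀) ∂μ| ∂ν
      ≤ ∫ x, m⁻¹ * ∫ g in E, |f x - f (g • x)| ∂μ ∂ν :=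
        integral_mono_of_nonneg (ae_of_all _ fun x => abs_nonneg _)
          (hint2.integral_prod_right.const_mul _) hle
    _ = m⁻¹ * ∫ g in E, ∫ x, |f x - f (g • x)| ∂ν ∂μ := by
        rw [integral_const_mul,
          integral_integral_swap (f := fun g x => |f x - f (g • x)|) hint2]
    _ ≤ m⁻¹ * ∫ g in E, ε ∂μ := by
        refine mul_le_mul_of_nonneg_left ?_ (inv_pos.mpr hm0).le
        exact setIntegral_mono_on hint2.integral_prod_left (integrable_const _) hEm hε
    _ = ε := by
        rw [setIntegral_const, smul_eq_mul, ← hm, inv_mul_cancel_left₀ hm0.ne']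

/-- The invariance of `1_A` holds only up to null sets, so transitivity cannot be applied to it
directly. Averaging the translates of `1_A` over a small neighbourhood of the identity gives a
function that is `K`-invariant at every point and close to `1_A` in `L¹`. -/
lemma ae_eq_const_of_koopman_indVec_eq [μ.IsOpenPosMeasure] [IsFiniteMeasureOnCompacts μ]
    [μ.IsMulRightInvariant]
    (hact : NullMeasurable (fun p : G × X => p.1 • p.2) (μ.prod ν))
    (hν : PreservesMeasureClass G ν) (hcont : IsStronglyContinuous (koopman (G := G) hν))
    (hKtrans : MulAction.IsPretransitive K X)
    (hKν : ∀ k ∈ K, MeasurePreserving (fun x : X => k • x) ν ν)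
    (hL : IsLengthFunction L) (hLK : IsBiInvariant K L) {A : Set X} (hA : MeasurableSet A)
    (hAK : ∀ k ∈ K, koopman hν k (indVec ν hA) = indVec ν hA) :
    ∃ c : ℝ, A.indicator (fun _ => (1 : ℝ)) =ᵐ[ν] fun _ => c := by
  have := hL.sigmaFinite μ
  refine ae_eq_const_of_forall_integral_le ((integrable_const (1 : ℝ)).indicator hA) fun ε hε => ?_
  set U : Set G := {g | ‖koopman hν g⁻¹ (indVec ν hA) - indVec ν hA‖
    + ‖koopman hν g⁻¹ (oneVec ν) - oneVec ν‖ < ε} with hU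
  have hUo : IsOpen U := by
    refine isOpen_lt ?_ continuous_const
    have h1 := (hcont (indVec ν hA)).comp continuous_inv
    have h2 := (hcont (oneVec ν)).comp continuous_inv
    exact (h1.sub continuous_const).norm.add (h2.sub continuous_const).norm
  have hU1 : (1 : G) ∈ U := by simpa [hU, koopman_one] using hε
  -- `π(k)` is isometric and fixes both vectors that define `U`.
  have hUK : ∀ k ∈ K, ∀ g, g * k ∈ U ↔ g ∈ U := by
    intro k hk g
    have key : ∀ v : Lp ℂ 2 ν, koopman hν k v = v →
        ‖koopman hν (g * k)⁻¹ v - v‖ = ‖koopman hν g⁻¹ v - v‖ := by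
      intro v hv
      rw [← (koopman hν k).norm_map, map_sub, hv, mul_inv_rev, koopman_mul, koopman_apply_inv]
    simp only [hU, Set.mem_ofPred_eq, key _ (hAK k hk),
      key _ (koopman_oneVec_of_measurePreserving hν (hKν k hk))]
  -- Intersecting `U` with a large ball makes the measure finite; it keeps right `K`-invariance,
  -- because `L` is `K`-invariant.
  obtain ⟨n, hn⟩ := exists_measure_inter_lengthBall_pos L μ
    (hUo.measure_pos μ ⟨1, hU1⟩).ne'
  refine exists_integral_abs_sub_const_le hact hKtrans hA hn
    ((measure_mono Set.inter_subset_right).trans_lt (hL.measure_lengthBall_lt_top μ n)).ne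
    (fun k hk g => ?_) ε (hUo.measurableSet.inter (hL.measurableSet_lengthBall n))
    fun g hg => (integral_abs_indicator_smul_sub_le hν hA g).trans (le_of_lt hg.1)
  rw [Set.mem_inter_iff, Set.mem_inter_iff, hUK k hk,
    show g * k ∈ lengthBall L n ↔ g ∈ lengthBall L n by
      simp only [lengthBall, Set.mem_ofPred_eq, (hLK k hk g).2]]

/-- The only `K`-invariant vectors of `L²(X, ν)` are the constant functions. -/
lemma eq_smul_oneVec_of_koopman_eq [μ.IsOpenPosMeasure] [IsFiniteMeasureOnCompacts μ]
    [μ.IsMulRightInvariant]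
    (hact : NullMeasurable (fun p : G × X => p.1 • p.2) (μ.prod ν))
    (hν : PreservesMeasureClass G ν) (hcont : IsStronglyContinuous (koopman (G := G) hν))
    (hKtrans : MulAction.IsPretransitive K X)
    (hKν : ∀ k ∈ K, MeasurePreserving (fun x : X => k • x) ν ν)
    (hL : IsLengthFunction L) (hLK : IsBiInvariant K L) {v : Lp ℂ 2 ν}
    (hv : ∀ k ∈ K, koopman hν k v = v) : ∃ c : ℂ, v = c • oneVec ν := by
  have hvm : Measurable v := (Lp.stronglyMeasurable v).measurable
  obtain ⟨c, hc⟩ : ∃ c : ℂ, (v : X → ℂ) =ᵐ[ν] fun _ => c := by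
    -- A function is a.e. constant once every preimage of a measurable set is null or conull. These
    -- preimages inherit `K`-invariance modulo null sets from `v`.
    refine exists_eventuallyEq_const_of_forall_separating MeasurableSet fun U hU => ?_
    have hA : MeasurableSet (v ⁻¹' U) := hvm hU
    obtain ⟨c, hc⟩ := ae_eq_const_of_koopman_indVec_eq hact hν hcont hKtrans hKν hL hLK hA
      fun k hk => by
        refine Lp.ext ?_
        filter_upwards [koopman_coeFn_of_measurePreserving hν (hKν k hk) (indVec ν hA),
          (hν.quasi k⁻¹).ae (indVec_coeFn hA), indVec_coeFn hA,
          koopman_coeFn_of_measurePreserving hν (hKν k hk) v] with x h1 h2 h3 h4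
        rw [h1, h2, h3]
        rw [hv k hk] at h4
        have h5 : k⁻¹ • x ∈ v ⁻¹' U ↔ x ∈ v ⁻¹' U := by
          rw [Set.mem_preimage, Set.mem_preimage, h4]
        by_cases h : x ∈ v ⁻¹' U
        · rw [Set.indicator_of_mem h, Set.indicator_of_mem (h5.mpr h)]
        · rw [Set.indicator_of_notMem h, Set.indicator_of_notMem (fun h' => h (h5.mp h'))]
    by_cases h1 : c = 1
    · left
      filter_upwards [hc] with x hx
      by_contra h
      have h' : x ∉ v ⁻¹' U := h
      simp [h', h1] at hx
    · right
      filter_upwards [hc] with x hx h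
      have h' : x ∈ v ⁻¹' U := h
      simp only [Set.indicator_of_mem h'] at hx
      exact h1 hx.symm
  refine ⟨c, Lp.ext ?_⟩
  filter_upwards [hc, Lp.coeFn_smul c (oneVec ν), oneVec_coeFn (ν := ν)] with x h1 h2 h3
  rw [h1, h2, Pi.smul_apply, h3, smul_eq_mul, mul_one]

end Ergodic

/-! ### Integrals of `π(g) ⊗ π(g⁻¹)` over bi-invariant sets -/

section TensorRep

set_option linter.unusedSectionVars false

variable {G : Type*} [Group G] [TopologicalSpace G] [IsTopologicalGroup G]
  [MeasurableSpace G] [BorelSpace G]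
  {μ : Measure G} {X : Type*} [MeasurableSpace X] {ν : Measure X} [IsProbabilityMeasure ν]
  [MulAction G X] [MeasurableConstSMul G X] {K : Subgroup G} {R : Set G}

/-- The operator `π(g) ⊗ π(g⁻¹)`. -/
noncomputable abbrev koopmanTensor (hν : PreservesMeasureClass G ν) (g : G) :
    HilbertTensor (Lp ℂ 2 ν) →L[ℂ] HilbertTensor (Lp ℂ 2 ν) :=
  tensorOp (koopman hν g).toContinuousLinearMap (koopman hν g⁻¹).toContinuousLinearMap

lemma continuous_koopmanTensor (hν : PreservesMeasureClass G ν)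
    (hcont : IsStronglyContinuous (koopman (G := G) hν)) (α : HilbertTensor (Lp ℂ 2 ν)) :
    Continuous fun g => koopmanTensor hν g α :=
  continuous_tensorOp hcont (fun v => (hcont v).comp continuous_inv) α

lemma norm_inner_koopmanTensor_le (hν : PreservesMeasureClass G ν)
    (α β : HilbertTensor (Lp ℂ 2 ν)) (g : G) :
    ‖⟪β, koopmanTensor hν g α⟫_ℂ‖ ≤ ‖β‖ * ‖α‖ :=
  (norm_inner_le_norm _ _).trans_eq (by rw [norm_tensorOp_isometry_apply])

lemma inner_tmul_koopmanTensor (hν : PreservesMeasureClass G ν) (v' w' v w : Lp ℂ 2 ν) (g : G) :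
    ⟪HilbertTensor.tmul v' w', koopmanTensor hν g (HilbertTensor.tmul v w)⟫_ℂ
      = ⟪v', koopman hν g v⟫_ℂ * ⟪w', koopman hν g⁻¹ w⟫_ℂ := by
  rw [HilbertTensor.tensorOp_tmul', HilbertTensor.inner_tmul]
  rfl

lemma aestronglyMeasurable_inner_koopmanTensor (hν : PreservesMeasureClass G ν)
    (hcont : IsStronglyContinuous (koopman (G := G) hν)) (α β : HilbertTensor (Lp ℂ 2 ν))
    (m : Measure G) : AEStronglyMeasurable (fun g => ⟪β, koopmanTensor hν g α⟫_ℂ) m :=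
  (continuous_const.inner (continuous_koopmanTensor hν hcont α)).measurable.aestronglyMeasurable

lemma integrable_inner_koopmanTensor (hν : PreservesMeasureClass G ν)
    (hcont : IsStronglyContinuous (koopman (G := G) hν)) (α β : HilbertTensor (Lp ℂ 2 ν))
    (m : Measure G) [IsFiniteMeasure m] :
    Integrable (fun g => ⟪β, koopmanTensor hν g α⟫_ℂ) m :=
  Integrable.of_bound (aestronglyMeasurable_inner_koopmanTensor hν hcont α β m) _
    (ae_of_all _ (norm_inner_koopmanTensor_le hν α β))

lemma exists_isOperatorIntegral_koopmanTensor (hν : PreservesMeasureClass G ν)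
    (hcont : IsStronglyContinuous (koopman (G := G) hν)) (m : Measure G) [IsFiniteMeasure m] :
    ∃ M, IsOperatorIntegral m (koopmanTensor hν) M :=
  exists_isOperatorIntegral m _
    (fun α β => aestronglyMeasurable_inner_koopmanTensor hν hcont α β m) 1
    fun _ => norm_tensorOp_isometry_le _ _

lemma inner_oneVec_koopman {k : G} (hν : PreservesMeasureClass G ν)
    (hk : koopman hν k⁻¹ (oneVec ν) = oneVec ν) (v : Lp ℂ 2 ν) :
    ⟪oneVec ν, koopman hν k v⟫_ℂ = ⟪oneVec ν, v⟫_ℂ := by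
  conv_rhs => rw [← hk, inner_koopman_left, inv_inv]

/-- As a form in `(v, w)` the integral is invariant under `K` in `v` by right translation of `g`,
and in `w` by left translation. For fixed `w` it is `⟨y, v⟩` with `y` a `K`-invariant vector, hence
a constant, so it depends on `v` only through `⟨1, v⟩`; likewise for `w`. The value at `(1, 1)`
gives the factor `∫ Ξ²`. -/
lemma setIntegral_inner_oneVec_koopman_mul [μ.IsMulLeftInvariant] [μ.IsMulRightInvariant]
    (hν : PreservesMeasureClass G ν) (hcont : IsStronglyContinuous (koopman (G := G) hν))
    (hK : ∀ v, (∀ k ∈ K, koopman hν k v = v) → ∃ c : ℂ, v = c • oneVec ν)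
    (hK1 : ∀ k ∈ K, koopman hν k (oneVec ν) = oneVec ν)
    (hR : IsBiInvariantSet K R) (hRtop : μ R < ∞) (v w : Lp ℂ 2 ν) :
    ∫ g in R, ⟪oneVec ν, koopman hν g v⟫_ℂ * ⟪oneVec ν, koopman hν g⁻¹ w⟫_ℂ ∂μ
      = ⟪oneVec ν, v⟫_ℂ * ⟪oneVec ν, w⟫_ℂ * ((∫ g in R, harishChandra ν g ^ 2 ∂μ : ℝ) : ℂ) := by
  have : Fact (μ R < ∞) := ⟨hRtop⟩
  obtain ⟨M, hM⟩ := exists_isOperatorIntegral_koopmanTensor hν hcont (μ.restrict R)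
  set Q : Lp ℂ 2 ν → Lp ℂ 2 ν → ℂ := fun v w =>
    ∫ g in R, ⟪oneVec ν, koopman hν g v⟫_ℂ * ⟪oneVec ν, koopman hν g⁻¹ w⟫_ℂ ∂μ with hQ
  -- This vector represents `Q` on elementary tensors, which makes `Q` continuous in each variable
  -- and provides the representing vectors `y` below.
  set u := ContinuousLinearMap.adjoint M (HilbertTensor.tmul (oneVec ν) (oneVec ν)) with hu
  have hQu : ∀ v w, ⟪u, HilbertTensor.tmul v w⟫_ℂ = Q v w := by
    intro v w
    rw [hu, ContinuousLinearMap.adjoint_inner_left, ← (hM _ _).2]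
    simp only [inner_tmul_koopmanTensor, hQ]
  have hinv₁ : ∀ k ∈ K, ∀ v w, Q (koopman hν k v) w = Q v w := by
    intro k hk v w
    have h := setIntegral_mul_right_eq μ (fun g => (hR k hk g).2) fun g =>
      ⟪oneVec ν, koopman hν g v⟫_ℂ * ⟪oneVec ν, koopman hν (g * k⁻¹)⁻¹ w⟫_ℂ
    simp only [mul_inv_cancel_right] at h
    simp only [hQ, ← koopman_mul]
    rw [h]
    congr 1 with g
    rw [mul_inv_rev, inv_inv, koopman_mul, inner_oneVec_koopman hν (hK1 _ (K.inv_mem hk))]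
  have hinv₂ : ∀ k ∈ K, ∀ v w, Q v (koopman hν k w) = Q v w := by
    intro k hk v w
    have h := setIntegral_mul_left_eq μ (fun g => (hR k⁻¹ (K.inv_mem hk) g).1) fun g =>
      ⟪oneVec ν, koopman hν (k * g) v⟫_ℂ * ⟪oneVec ν, koopman hν g⁻¹ w⟫_ℂ
    simp only [mul_inv_cancel_left, mul_inv_rev, inv_inv] at h
    simp only [hQ, ← koopman_mul]
    rw [h]
    congr 1 with g
    rw [koopman_mul, inner_oneVec_koopman hν (hK1 _ (K.inv_mem hk))]
  have hfac₁ : ∀ v w, Q v w = ⟪oneVec ν, v⟫_ℂ * Q (oneVec ν) w := by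
    intro v w
    set y := ContinuousLinearMap.adjoint (HilbertTensor.tmulL.flip w) u with hy
    have hyQ : ∀ v, ⟪y, v⟫_ℂ = Q v w := fun v => by
      rw [hy, ContinuousLinearMap.adjoint_inner_left]
      exact hQu v w
    obtain ⟨c, hc⟩ := hK y fun k hk => ext_inner_right ℂ fun v => by
      rw [inner_koopman_left, hyQ, hyQ, hinv₁ _ (K.inv_mem hk)]
    rw [← hyQ, ← hyQ, hc, inner_smul_left, inner_smul_left, inner_oneVec_oneVec]
    ring
  have hfac₂ : ∀ v w, Q v w = ⟪oneVec ν, w⟫_ℂ * Q v (oneVec ν) := by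
    intro v w
    set y := ContinuousLinearMap.adjoint (HilbertTensor.tmulL v) u with hy
    have hyQ : ∀ w, ⟪y, w⟫_ℂ = Q v w := fun w => by
      rw [hy, ContinuousLinearMap.adjoint_inner_left]
      exact hQu v w
    obtain ⟨c, hc⟩ := hK y fun k hk => ext_inner_right ℂ fun w => by
      rw [inner_koopman_left, hyQ, hyQ, hinv₂ _ (K.inv_mem hk)]
    rw [← hyQ, ← hyQ, hc, inner_smul_left, inner_smul_left, inner_oneVec_oneVec]
    ring
  have h11 : Q (oneVec ν) (oneVec ν) = ((∫ g in R, harishChandra ν g ^ 2 ∂μ : ℝ) : ℂ) := by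
    rw [← integral_complex_ofReal]
    simp only [hQ, ← harishChandra_eq_inner, harishChandra_inv hν, sq, Complex.ofReal_mul]
  change Q v w = _
  rw [hfac₁, hfac₂, h11]
  ring

lemma setIntegral_indCoeff_mul [μ.IsMulLeftInvariant] [μ.IsMulRightInvariant]
    (hν : PreservesMeasureClass G ν) (hcont : IsStronglyContinuous (koopman (G := G) hν))
    (hK : ∀ v, (∀ k ∈ K, koopman hν k v = v) → ∃ c : ℂ, v = c • oneVec ν)
    (hK1 : ∀ k ∈ K, koopman hν k (oneVec ν) = oneVec ν)
    (hR : IsBiInvariantSet K R) (hRtop : μ R < ∞) {A B : Set X}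
    (hA : MeasurableSet A) (hB : MeasurableSet B) :
    ∫ g in R, indCoeff hν g MeasurableSet.univ hA * indCoeff hν g⁻¹ MeasurableSet.univ hB ∂μ
      = ν.real A * ν.real B * ∫ g in R, harishChandra ν g ^ 2 ∂μ := by
  have h := setIntegral_inner_oneVec_koopman_mul hν hcont hK hK1 hR hRtop
    (indVec ν hA) (indVec ν hB)
  have hone : ∀ {A : Set X} (hA : MeasurableSet A), ⟪oneVec ν, indVec ν hA⟫_ℂ = ν.real A := by
    intro A hA
    rw [oneVec, indVec, indVec, L2.inner_indicatorConstLp_one_indicatorConstLp_one]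
    simp
  rw [hone, hone] at h
  simp only [oneVec, ← ofReal_indCoeff, ← Complex.ofReal_mul] at h
  rw [integral_complex_ofReal] at h
  exact_mod_cast h

end TensorRep

/-! ### Step tensors -/

section Step

variable {X : Type*} [MeasurableSpace X] {ν : Measure X} [IsProbabilityMeasure ν]
  {ι κ : Type*}

lemma indVec_eq_sum {q : X → κ} (hq : ∀ j, MeasurableSet (q ⁻¹' {j})) (T : Finset κ) {A : Set X}
    (hA : MeasurableSet A) (hAT : A = q ⁻¹' T) :
    indVec ν hA = ∑ j ∈ T, indVec ν (hq j) := by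
  refine ext_inner_right ℂ fun v => ?_
  have hv : Integrable v ν := (Lp.memLp v).integrable (by norm_num)
  rw [sum_inner]
  simp only [indVec, L2.inner_indicatorConstLp_one]
  rw [← integral_biUnion_finset T (fun j _ => hq j) ?_ fun j _ => hv.integrableOn]
  · congr 2
    rw [hAT]
    ext x
    simp
  · intro i _ j _ hij
    exact Disjoint.preimage q (Set.disjoint_singleton.mpr hij)

variable [Fintype ι] [Fintype κ]

lemma sum_indVec {q : X → κ} (hq : ∀ j, MeasurableSet (q ⁻¹' {j})) :
    ∑ j, indVec ν (hq j) = oneVec ν :=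
  (indVec_eq_sum hq Finset.univ _ (by simp)).symm

/-- The tensor `∑ a(i, j) 1_{P_i} ⊗ 1_{P_j}`, where the `P_i` are the fibres of a map to a finite
set. -/
noncomputable def stepTensor (ν : Measure X) [IsProbabilityMeasure ν] {p : X → ι}
    (hp : ∀ i, MeasurableSet (p ⁻¹' {i})) (a : ι × ι → ℂ) : HilbertTensor (Lp ℂ 2 ν) :=
  ∑ x, a x • HilbertTensor.tmul (indVec ν (hp x.1)) (indVec ν (hp x.2))

lemma stepTensor_refine [DecidableEq ι] {p : X → ι} {q : X → κ} (f : κ → ι) (hpq : p = f ∘ q)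
    (hp : ∀ i, MeasurableSet (p ⁻¹' {i})) (hq : ∀ j, MeasurableSet (q ⁻¹' {j}))
    (a : ι × ι → ℂ) :
    stepTensor ν hp a = stepTensor ν hq (fun y => a (f y.1, f y.2)) := by
  have h : ∀ i, indVec ν (hp i) = ∑ j with f j = i, indVec ν (hq j) := fun i =>
    indVec_eq_sum hq _ _ (by ext x; simp [hpq])
  rw [stepTensor, stepTensor, ← Finset.sum_fiberwise Finset.univ fun y : κ × κ => (f y.1, f y.2)]
  refine Finset.sum_congr rfl fun x _ => ?_
  simp only [h, ← HilbertTensor.tmulL_apply, map_sum, _root_.sum_apply]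
  rw [Finset.sum_comm, ← Finset.sum_product', Finset.smul_sum]
  refine Finset.sum_congr ?_ fun y hy => ?_
  · ext y
    simp [Prod.ext_iff]
  · simp only [Finset.mem_filter, Finset.mem_univ, true_and] at hy
    rw [hy]

lemma norm_sq_stepTensor {p : X → ι} (hp : ∀ i, MeasurableSet (p ⁻¹' {i})) (a : ι × ι → ℂ) :
    ‖stepTensor ν hp a‖ ^ 2
      = ∑ x, ‖a x‖ ^ 2 * (ν.real (p ⁻¹' {x.1}) * ν.real (p ⁻¹' {x.2})) := by
  classical
  have hind : ∀ i j, ⟪indVec ν (hp i), indVec ν (hp j)⟫_ℂ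
      = if i = j then (ν.real (p ⁻¹' {i}) : ℂ) else 0 := by
    intro i j
    rw [indVec, indVec, L2.inner_indicatorConstLp_one_indicatorConstLp_one]
    split_ifs with h
    · rw [h, Set.inter_self]
      rfl
    · rw [(Disjoint.preimage p (Set.disjoint_singleton.mpr h)).inter_eq]
      simp
  have h : (⟪stepTensor ν hp a, stepTensor ν hp a⟫_ℂ)
      = ((∑ x, ‖a x‖ ^ 2 * (ν.real (p ⁻¹' {x.1}) * ν.real (p ⁻¹' {x.2})) : ℝ) : ℂ) := by
    rw [stepTensor, sum_inner, Complex.ofReal_sum]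
    refine Finset.sum_congr rfl fun x _ => ?_
    rw [inner_sum, Finset.sum_eq_single x]
    · rw [inner_smul_left, inner_smul_right, HilbertTensor.inner_tmul, hind, hind, if_pos rfl,
        if_pos rfl, ← mul_assoc, Complex.conj_mul']
      push_cast
      ring
    · intro y _ hyx
      rw [inner_smul_left, inner_smul_right, HilbertTensor.inner_tmul, hind, hind]
      by_cases h1 : x.1 = y.1
      · have h2 : x.2 ≠ y.2 := fun h2 => hyx (Prod.ext h1.symm h2.symm)
        rw [if_neg h2]
        simp
      · rw [if_neg h1]
        simp
    · simp
  rw [inner_self_eq_norm_sq_to_K] at h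
  exact Complex.ofReal_injective (by rw [← h, Complex.ofReal_pow]; rfl)

/-- The fibres of `(p, q)` refine both partitions. Sums of step tensors, and pairs `(α, β)` in the
Schur test, can thus be handled over a single partition. -/
lemma exists_common_stepTensor {p : X → ι} {q : X → κ} (hp : ∀ i, MeasurableSet (p ⁻¹' {i}))
    (hq : ∀ j, MeasurableSet (q ⁻¹' {j})) (a : ι × ι → ℂ) (b : κ × κ → ℂ) :
    ∃ (r : X → ι × κ) (hr : ∀ k, MeasurableSet (r ⁻¹' {k})) (a' b' : (ι × κ) × (ι × κ) → ℂ),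
      stepTensor ν hp a = stepTensor ν hr a' ∧ stepTensor ν hq b = stepTensor ν hr b' := by
  classical
  have hr : ∀ k : ι × κ, MeasurableSet ((fun x => (p x, q x)) ⁻¹' {k}) := by
    rintro ⟨i, j⟩
    have : (fun x => (p x, q x)) ⁻¹' {(i, j)} = p ⁻¹' {i} ∩ q ⁻¹' {j} := by
      ext x; simp
    rw [this]
    exact (hp i).inter (hq j)
  exact ⟨_, hr, _, _, stepTensor_refine Prod.fst rfl hp hr a, stepTensor_refine Prod.snd rfl hq hr b⟩

/-- The set of all step tensors. -/
def stepTensors (ν : Measure X) [IsProbabilityMeasure ν] : Set (HilbertTensor (Lp ℂ 2 ν)) :=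
  {α | ∃ (ι : Type) (_ : Fintype ι) (p : X → ι) (hp : ∀ i, MeasurableSet (p ⁻¹' {i}))
    (a : ι × ι → ℂ), α = stepTensor ν hp a}

lemma dense_stepTensors (ν : Measure X) [IsProbabilityMeasure ν] : Dense (stepTensors ν) := by
  classical
  let V : Submodule ℂ (HilbertTensor (Lp ℂ 2 ν)) :=
    { carrier := stepTensors ν
      zero_mem' := ⟨Unit, inferInstance, fun _ => (), fun i => by simp, 0, by simp [stepTensor]⟩
      add_mem' := by
        rintro _ _ ⟨ι, _, p, hp, a, rfl⟩ ⟨κ, _, q, hq, b, rfl⟩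
        obtain ⟨r, hr, a', b', ha, hb⟩ := exists_common_stepTensor (ν := ν) hp hq a b
        refine ⟨ι × κ, inferInstance, r, hr, a' + b', ?_⟩
        rw [ha, hb]
        simp [stepTensor, add_smul, Finset.sum_add_distrib]
      smul_mem' := by
        rintro c _ ⟨ι, _, p, hp, a, rfl⟩
        refine ⟨ι, inferInstance, p, hp, c • a, ?_⟩
        simp [stepTensor, Finset.smul_sum, mul_smul] }
  intro α
  refine HilbertTensor.closed_induction (p := fun α => α ∈ V.topologicalClosure) _
    (dense_span_indVec ν) V.isClosed_topologicalClosure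
    (fun _ _ => V.topologicalClosure.add_mem) (fun c _ => V.topologicalClosure.smul_mem c)
    V.topologicalClosure.zero_mem ?_ α
  rintro _ ⟨A, hA, rfl⟩ _ ⟨B, hB, rfl⟩
  refine V.le_topologicalClosure ?_
  -- The partition generated by `A` and `B`, over which `1_A ⊗ 1_B` has coefficients `0` and `1`.
  let p : X → Bool × Bool := fun x => (if x ∈ A then true else false, if x ∈ B then true else false)
  have hp : ∀ i, MeasurableSet (p ⁻¹' {i}) := by
    have hp' : Measurable p := (Measurable.ite hA measurable_const measurable_const).prodMk
      (Measurable.ite hB measurable_const measurable_const)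
    exact fun i => hp' (measurableSet_singleton i)
  have h1 : indVec ν hA = ∑ j with j.1 = true, indVec ν (hp j) :=
    indVec_eq_sum hp _ hA (by ext x; simp [p])
  have h2 : indVec ν hB = ∑ j with j.2 = true, indVec ν (hp j) :=
    indVec_eq_sum hp _ hB (by ext x; simp [p])
  refine ⟨Bool × Bool, inferInstance, p, hp,
    fun x => if x.1.1 = true ∧ x.2.2 = true then 1 else 0, ?_⟩
  rw [h1, h2]
  simp only [← HilbertTensor.tmulL_apply, map_sum, _root_.sum_apply, stepTensor,
    ite_smul, one_smul, zero_smul]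
  rw [Finset.sum_comm, ← Finset.sum_product', ← Finset.sum_filter]
  refine Finset.sum_congr ?_ fun _ _ => rfl
  ext y
  simp

end Step

/-! ### The uniform bound -/

/-- Schur test: with non-negative entries, `|a| |b| ≤ (|a|² + |b|²) / 2` reduces the bilinear sum to
row and column sums. -/
lemma norm_sum_sum_conj_mul_le {σ τ : Type*} [Fintype σ] [Fintype τ] (a : σ → ℂ) (b : τ → ℂ)
    (c : τ → σ → ℝ) (hc : ∀ y x, 0 ≤ c y x) :
    ‖∑ y, ∑ x, starRingEnd ℂ (b y) * (a x * (c y x : ℂ))‖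
      ≤ (∑ x, ‖a x‖ ^ 2 * ∑ y, c y x + ∑ y, ‖b y‖ ^ 2 * ∑ x, c y x) / 2 := by
  have h1 : ∀ y x, ‖starRingEnd ℂ (b y) * (a x * (c y x : ℂ))‖
      ≤ (‖a x‖ ^ 2 * c y x + ‖b y‖ ^ 2 * c y x) / 2 := by
    intro y x
    rw [norm_mul, norm_mul, Complex.norm_real, Real.norm_of_nonneg (hc y x), RCLike.norm_conj]
    nlinarith [mul_nonneg (sq_nonneg (‖a x‖ - ‖b y‖)) (hc y x)]
  calc ‖∑ y, ∑ x, starRingEnd ℂ (b y) * (a x * (c y x : ℂ))‖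
      ≤ ∑ y, ∑ x, (‖a x‖ ^ 2 * c y x + ‖b y‖ ^ 2 * c y x) / 2 :=
        (norm_sum_le _ _).trans (Finset.sum_le_sum fun y _ =>
          (norm_sum_le _ _).trans (Finset.sum_le_sum fun x _ => h1 y x))
    _ = _ := by
        simp only [← Finset.sum_div, Finset.sum_add_distrib, Finset.mul_sum]
        rw [Finset.sum_comm]

lemma Dense.le_of_forall_mem_le {E : Type*} [TopologicalSpace E] {D : Set E} (hD : Dense D)
    {F J : E × E → ℝ} (hF : Continuous F) (hJ : Continuous J)
    (h : ∀ α ∈ D, ∀ β ∈ D, F (α, β) ≤ J (α, β)) (α β : E) : F (α, β) ≤ J (α, β) := by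
  have hsub : D ×ˢ D ⊆ {q | F q ≤ J q} := fun q hq => h q.1 hq.1 q.2 hq.2
  exact closure_minimal hsub (isClosed_le hF hJ) ((hD.prod hD) (α, β))

/-! ### The integrated Schur test for coefficients of `π(g) ⊗ π(g⁻¹)`. -/

section Bound

set_option linter.unusedSectionVars false

variable {G : Type*} [Group G] [TopologicalSpace G] [IsTopologicalGroup G]
  [MeasurableSpace G] [BorelSpace G]
  {μ : Measure G} {X : Type*} [MeasurableSpace X] {ν : Measure X} [IsProbabilityMeasure ν]
  [MulAction G X] [MeasurableConstSMul G X] {K : Subgroup G} {R : Set G}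

lemma sum_indCoeff_left {ι : Type*} [Fintype ι] (hν : PreservesMeasureClass G ν) (g : G)
    {p : X → ι} (hp : ∀ i, MeasurableSet (p ⁻¹' {i})) {A : Set X} (hA : MeasurableSet A) :
    ∑ i, indCoeff hν g (hp i) hA = indCoeff hν g MeasurableSet.univ hA := by
  simp only [indCoeff]
  rw [← Complex.re_sum, ← sum_inner, sum_indVec hp, oneVec]

lemma sum_indCoeff_right {ι : Type*} [Fintype ι] (hν : PreservesMeasureClass G ν) (g : G)
    {p : X → ι} (hp : ∀ i, MeasurableSet (p ⁻¹' {i})) {A : Set X} (hA : MeasurableSet A) :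
    ∑ i, indCoeff hν g hA (hp i) = indCoeff hν g hA MeasurableSet.univ := by
  simp only [← indCoeff_inv hν g]
  exact sum_indCoeff_left hν g⁻¹ hp hA

lemma continuous_indCoeff (hν : PreservesMeasureClass G ν)
    (hcont : IsStronglyContinuous (koopman (G := G) hν)) {A B : Set X} (hA : MeasurableSet A)
    (hB : MeasurableSet B) : Continuous fun g : G => indCoeff hν g hA hB :=
  Complex.continuous_re.comp (continuous_const.inner (hcont _))

lemma indCoeff_le (hν : PreservesMeasureClass G ν) (g : G) {A B : Set X} (hA : MeasurableSet A)
    (hB : MeasurableSet B) : indCoeff hν g hA hB ≤ ‖indVec ν hA‖ * ‖indVec ν hB‖ :=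
  (Complex.re_le_norm _).trans ((norm_inner_le_norm _ _).trans_eq
    (by rw [LinearIsometry.norm_map]))

lemma integrable_indCoeff_mul (hν : PreservesMeasureClass G ν)
    (hcont : IsStronglyContinuous (koopman (G := G) hν)) {A B A' B' : Set X}
    (hA : MeasurableSet A) (hB : MeasurableSet B) (hA' : MeasurableSet A')
    (hB' : MeasurableSet B') (m : Measure G) [IsFiniteMeasure m] :
    Integrable (fun g => indCoeff hν g hA hB * indCoeff hν g⁻¹ hA' hB') m := by
  refine Integrable.of_bound ((continuous_indCoeff hν hcont hA hB).mul
    ((continuous_indCoeff hν hcont hA' hB').comp continuous_inv)).measurable.aestronglyMeasurable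
    (‖indVec ν hA‖ * ‖indVec ν hB‖ * (‖indVec ν hA'‖ * ‖indVec ν hB'‖)) (ae_of_all _ fun g => ?_)
  rw [norm_mul, Real.norm_of_nonneg (indCoeff_nonneg hν _ _ _),
    Real.norm_of_nonneg (indCoeff_nonneg hν _ _ _)]
  exact mul_le_mul (indCoeff_le hν _ _ _) (indCoeff_le hν _ _ _) (indCoeff_nonneg hν _ _ _)
    (by positivity)

lemma norm_inner_stepTensor_le {ι : Type*} [Fintype ι] (hν : PreservesMeasureClass G ν) (g : G)
    {p : X → ι} (hp : ∀ i, MeasurableSet (p ⁻¹' {i})) (a b : ι × ι → ℂ) :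
    ‖⟪stepTensor ν hp b, koopmanTensor hν g (stepTensor ν hp a)⟫_ℂ‖
      ≤ (∑ x, ‖a x‖ ^ 2 * (indCoeff hν g MeasurableSet.univ (hp x.1)
            * indCoeff hν g⁻¹ MeasurableSet.univ (hp x.2))
        + ∑ y, ‖b y‖ ^ 2 * (indCoeff hν g MeasurableSet.univ (hp y.2)
            * indCoeff hν g⁻¹ MeasurableSet.univ (hp y.1))) / 2 := by
  set c : ι × ι → ι × ι → ℝ := fun y x =>
    indCoeff hν g (hp y.1) (hp x.1) * indCoeff hν g⁻¹ (hp y.2) (hp x.2) with hc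
  have h1 : ⟪stepTensor ν hp b, koopmanTensor hν g (stepTensor ν hp a)⟫_ℂ
      = ∑ y, ∑ x, starRingEnd ℂ (b y) * (a x * (c y x : ℂ)) := by
    simp only [stepTensor, sum_inner, map_sum, inner_sum, map_smul, inner_smul_left,
      inner_smul_right, inner_tmul_koopmanTensor, ← ofReal_indCoeff, hc, Complex.ofReal_mul,
      Finset.mul_sum]
    rw [Finset.sum_comm]
    exact Finset.sum_congr rfl fun y _ => Finset.sum_congr rfl fun x _ => by ring
  have h2 : ∀ x, ∑ y, c y x = indCoeff hν g MeasurableSet.univ (hp x.1)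
      * indCoeff hν g⁻¹ MeasurableSet.univ (hp x.2) := by
    intro x
    rw [← sum_indCoeff_left hν g hp, ← sum_indCoeff_left hν g⁻¹ hp, Finset.sum_mul_sum,
      ← Finset.sum_product']
    rfl
  -- Moving `π` to the other side of the inner product exchanges `g` and `g⁻¹`, hence the swapped
  -- indices `y.2` and `y.1`.
  have h3 : ∀ y, ∑ x, c y x = indCoeff hν g MeasurableSet.univ (hp y.2)
      * indCoeff hν g⁻¹ MeasurableSet.univ (hp y.1) := by
    intro y
    rw [indCoeff_inv, ← indCoeff_inv hν g, ← sum_indCoeff_right hν g hp,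
      ← sum_indCoeff_right hν g⁻¹ hp, mul_comm, Finset.sum_mul_sum, ← Finset.sum_product']
    rfl
  rw [h1]
  refine (norm_sum_sum_conj_mul_le a b c fun y x =>
    mul_nonneg (indCoeff_nonneg hν _ _ _) (indCoeff_nonneg hν _ _ _)).trans_eq ?_
  simp only [h2, h3]

/-- Under `hI` each row or column sum integrates to `ν(P_i) ν(P_j) I`, which is exactly the weight
of `|a(i, j)|²` in `‖stepTensor‖²`; the Schur test therefore loses no constant. -/
lemma setIntegral_norm_inner_stepTensor_le {ι : Type*} [Fintype ι]
    (hν : PreservesMeasureClass G ν) (hcont : IsStronglyContinuous (koopman (G := G) hν))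
    (hRtop : μ R < ∞) (I : ℝ)
    (hI : ∀ (A B : Set X) (hA : MeasurableSet A) (hB : MeasurableSet B),
      ∫ g in R, indCoeff hν g MeasurableSet.univ hA * indCoeff hν g⁻¹ MeasurableSet.univ hB ∂μ
        = ν.real A * ν.real B * I)
    {p : X → ι} (hp : ∀ i, MeasurableSet (p ⁻¹' {i})) (a b : ι × ι → ℂ) :
    ∫ g in R, ‖⟪stepTensor ν hp b, koopmanTensor hν g (stepTensor ν hp a)⟫_ℂ‖ ∂μ
      ≤ (‖stepTensor ν hp a‖ ^ 2 + ‖stepTensor ν hp b‖ ^ 2) / 2 * I := by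
  have : Fact (μ R < ∞) := ⟨hRtop⟩
  have hint : ∀ (c : ι × ι → ℂ) (s t : ι × ι → ι), ∀ x ∈ (Finset.univ : Finset (ι × ι)),
      Integrable (fun g => ‖c x‖ ^ 2 * (indCoeff hν g MeasurableSet.univ (hp (s x))
        * indCoeff hν g⁻¹ MeasurableSet.univ (hp (t x)))) (μ.restrict R) := fun c s t x _ =>
    (integrable_indCoeff_mul hν hcont _ _ _ _ _).const_mul _
  refine (integral_mono (integrable_inner_koopmanTensor hν hcont _ _ _).norm
    (((integrable_finsetSum _ (hint a Prod.fst Prod.snd)).add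
      (integrable_finsetSum _ (hint b Prod.snd Prod.fst))).div_const 2)
    fun g => norm_inner_stepTensor_le hν g hp a b).trans_eq ?_
  simp only [Pi.add_apply]
  rw [integral_div, integral_add (integrable_finsetSum _ (hint a Prod.fst Prod.snd))
    (integrable_finsetSum _ (hint b Prod.snd Prod.fst)),
    integral_finsetSum _ (hint a Prod.fst Prod.snd),
    integral_finsetSum _ (hint b Prod.snd Prod.fst)]
  simp only [integral_const_mul, hI]
  rw [norm_sq_stepTensor, norm_sq_stepTensor, div_mul_eq_mul_div, add_mul, Finset.sum_mul,
    Finset.sum_mul]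
  congr 2
  · exact Finset.sum_congr rfl fun x _ => by ring
  · exact Finset.sum_congr rfl fun x _ => by ring

lemma continuous_setIntegral_norm_inner (hν : PreservesMeasureClass G ν)
    (hcont : IsStronglyContinuous (koopman (G := G) hν)) (m : Measure G) [IsFiniteMeasure m] :
    Continuous fun q : HilbertTensor (Lp ℂ 2 ν) × HilbertTensor (Lp ℂ 2 ν) =>
      ∫ g, ‖⟪q.2, koopmanTensor hν g q.1⟫_ℂ‖ ∂m := by
  refine continuous_iff_continuousAt.mpr fun q₀ => ?_
  refine continuousAt_of_dominated (bound := fun _ => (‖q₀.2‖ + 1) * (‖q₀.1‖ + 1)) ?_ ?_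
    (integrable_const _) ?_
  · exact Eventually.of_forall fun q =>
      (aestronglyMeasurable_inner_koopmanTensor hν hcont _ _ _).norm
  · have h1 : ∀ᶠ q : HilbertTensor (Lp ℂ 2 ν) × HilbertTensor (Lp ℂ 2 ν) in 𝓝 q₀,
        ‖q.1‖ < ‖q₀.1‖ + 1 :=
      (continuous_fst.norm.tendsto q₀).eventually_lt_const (lt_add_one _)
    have h2 : ∀ᶠ q : HilbertTensor (Lp ℂ 2 ν) × HilbertTensor (Lp ℂ 2 ν) in 𝓝 q₀,
        ‖q.2‖ < ‖q₀.2‖ + 1 :=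
      (continuous_snd.norm.tendsto q₀).eventually_lt_const (lt_add_one _)
    filter_upwards [h1, h2] with q hq1 hq2
    refine ae_of_all _ fun g => ?_
    rw [norm_norm]
    exact (norm_inner_koopmanTensor_le hν _ _ g).trans
      (mul_le_mul hq2.le hq1.le (norm_nonneg _) (by positivity))
  · refine ae_of_all _ fun g => Continuous.continuousAt ?_
    have h1 : Continuous fun q : HilbertTensor (Lp ℂ 2 ν) × HilbertTensor (Lp ℂ 2 ν) =>
        koopmanTensor hν g q.1 := (ContinuousLinearMap.continuous _).comp continuous_fst
    exact (Continuous.inner continuous_snd h1).norm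

lemma setIntegral_norm_inner_le_half
    (hν : PreservesMeasureClass G ν) (hcont : IsStronglyContinuous (koopman (G := G) hν))
    (hRtop : μ R < ∞) (I : ℝ)
    (hI : ∀ (A B : Set X) (hA : MeasurableSet A) (hB : MeasurableSet B),
      ∫ g in R, indCoeff hν g MeasurableSet.univ hA * indCoeff hν g⁻¹ MeasurableSet.univ hB ∂μ
        = ν.real A * ν.real B * I) (α β : HilbertTensor (Lp ℂ 2 ν)) :
    ∫ g in R, ‖⟪β, koopmanTensor hν g α⟫_ℂ‖ ∂μ ≤ (‖α‖ ^ 2 + ‖β‖ ^ 2) / 2 * I := by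
  have : Fact (μ R < ∞) := ⟨hRtop⟩
  refine (dense_stepTensors ν).le_of_forall_mem_le
    (F := fun q => ∫ g in R, ‖⟪q.2, koopmanTensor hν g q.1⟫_ℂ‖ ∂μ)
    (continuous_setIntegral_norm_inner hν hcont (μ.restrict R))
    (J := fun q => (‖q.1‖ ^ 2 + ‖q.2‖ ^ 2) / 2 * I) (by fun_prop) ?_ α β
  rintro α ⟨ι, _, p, hp, a, hα⟩ β ⟨κ, _, q, hq, b, hβ⟩
  obtain ⟨r, hr, a', b', ha, hb⟩ := exists_common_stepTensor (ν := ν) hp hq a b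
  have h := setIntegral_norm_inner_stepTensor_le hν hcont hRtop I hI hr a' b'
  rw [← ha, ← hb, ← hα, ← hβ] at h
  exact h

lemma setIntegral_norm_inner_le
    (hν : PreservesMeasureClass G ν) (hcont : IsStronglyContinuous (koopman (G := G) hν))
    (hRtop : μ R < ∞) (I : ℝ)
    (hI : ∀ (A B : Set X) (hA : MeasurableSet A) (hB : MeasurableSet B),
      ∫ g in R, indCoeff hν g MeasurableSet.univ hA * indCoeff hν g⁻¹ MeasurableSet.univ hB ∂μ
        = ν.real A * ν.real B * I) (α β : HilbertTensor (Lp ℂ 2 ν)) :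
    ∫ g in R, ‖⟪β, koopmanTensor hν g α⟫_ℂ‖ ∂μ ≤ ‖α‖ * ‖β‖ * I := by
  by_cases hα : α = 0
  · simp [hα]
  by_cases hβ : β = 0
  · simp [hβ]
  have hα' : 0 < ‖α‖ := norm_pos_iff.mpr hα
  have hβ' : 0 < ‖β‖ := norm_pos_iff.mpr hβ
  -- Normalising both vectors turns the half-sum of squares into the product of the norms.
  have h := setIntegral_norm_inner_le_half hν hcont hRtop I hI
    (((‖α‖⁻¹ : ℝ) : ℂ) • α) (((‖β‖⁻¹ : ℝ) : ℂ) • β)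
  simp only [map_smul, inner_smul_left, inner_smul_right, norm_mul, norm_smul, Complex.norm_real,
    RCLike.norm_conj, norm_inv, norm_norm, inv_mul_cancel₀ hα'.ne', inv_mul_cancel₀ hβ'.ne',
    integral_const_mul] at h
  rw [← mul_assoc, ← mul_inv, inv_mul_le_iff₀ (by positivity)] at h
  linarith

end Bound

/-! ### Operators intertwining the two factors of a tensor square -/

section Intertwining

variable {G H : Type*} [Group G] [NormedAddCommGroup H] [InnerProductSpace ℂ H]
  {π : G → H →ₗᵢ[ℂ] H}

lemma inner_apply_inv_left (hinv : ∀ g v, π g (π g⁻¹ v) = v) (g : G) (v w : H) :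
    ⟪π g⁻¹ v, w⟫_ℂ = ⟪v, π g w⟫_ℂ := by
  conv_rhs => rw [← hinv g v, LinearIsometry.inner_map_map]

lemma HilbertTensor.clm_ext_inner {S T : HilbertTensor H →L[ℂ] HilbertTensor H}
    (h : ∀ v' w' v w, ⟪tmul v' w', S (tmul v w)⟫_ℂ = ⟪tmul v' w', T (tmul v w)⟫_ℂ) : S = T := by
  have h1 : ∀ v w, S (tmul v w) = T (tmul v w) := by
    intro v w
    refine ext_inner_left ℂ fun β => ?_
    induction β using HilbertTensor.tmul_induction with
    | hclosed =>
      exact isClosed_eq (continuous_id.inner continuous_const) (continuous_id.inner continuous_const)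
    | hadd α β hα hβ => rw [inner_add_left, inner_add_left, hα, hβ]
    | hsmul c α hα => rw [inner_smul_left, inner_smul_left, hα]
    | h0 => rw [inner_zero_left, inner_zero_left]
    | htmul v' w' => exact h v' w' v w
  ext α
  induction α using HilbertTensor.tmul_induction with
  | hclosed => exact isClosed_eq S.continuous T.continuous
  | hadd α β hα hβ => rw [map_add, map_add, hα, hβ]
  | hsmul c α hα => rw [map_smul, map_smul, hα]
  | h0 => rw [map_zero, map_zero]
  | htmul v w => exact h1 v w

lemma exists_clm_inner_eq_inner_comp {E : Type*} [NormedAddCommGroup E] [InnerProductSpace ℂ E]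
    [CompleteSpace E] [CompleteSpace H] (J J' : H →L[ℂ] E) (S : E →L[ℂ] E) :
    ∃ A : H →L[ℂ] H, ∀ x y, ⟪x, A y⟫_ℂ = ⟪J' x, S (J y)⟫_ℂ := by
  refine ⟨(ContinuousLinearMap.adjoint J').comp (S.comp J), fun x y => ?_⟩
  rw [ContinuousLinearMap.comp_apply, ContinuousLinearMap.adjoint_inner_right,
    ContinuousLinearMap.comp_apply]

/-- The flip is, up to a scalar, the only operator that intertwines `π ⊗ 1` with `1 ⊗ π` and
`1 ⊗ π` with `π ⊗ 1`. -/
lemma IsIrreducibleRep.eq_flipOp [CompleteSpace H] (hirr : IsIrreducibleRep π)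
    (hinv : ∀ g v, π g (π g⁻¹ v) = v) (S : HilbertTensor H →L[ℂ] HilbertTensor H)
    (h₁ : ∀ g v' w' v w, ⟪HilbertTensor.tmul (π g⁻¹ v') w', S (HilbertTensor.tmul v w)⟫_ℂ
      = ⟪HilbertTensor.tmul v' w', S (HilbertTensor.tmul v (π g w))⟫_ℂ)
    (h₂ : ∀ g v' w' v w, ⟪HilbertTensor.tmul v' (π g⁻¹ w'), S (HilbertTensor.tmul v w)⟫_ℂ
      = ⟪HilbertTensor.tmul v' w', S (HilbertTensor.tmul (π g v) w)⟫_ℂ)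
    (e : H) (he : ‖e‖ = 1)
    (hS : ⟪HilbertTensor.tmul e e, S (HilbertTensor.tmul e e)⟫_ℂ = 1) : S = flipOp H := by
  have hee : ⟪e, e⟫_ℂ = 1 := by rw [inner_self_eq_norm_sq_to_K, he]; simp
  -- With `w'` and `v` fixed, `h₁` says that the operator in the remaining pair of variables
  -- commutes with `π`, so Schur's lemma makes it a scalar. `hB` does the same with the roles
  -- exchanged, and comparing the two at `v' = w = e` determines `a`.
  have hA : ∀ w' v, ∃ a : ℂ, ∀ v' w,
      ⟪HilbertTensor.tmul v' w', S (HilbertTensor.tmul v w)⟫_ℂ = a * ⟪v', w⟫_ℂ := by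
    intro w' v
    obtain ⟨A, hAi⟩ : ∃ A : H →L[ℂ] H, ∀ v' w, ⟪v', A w⟫_ℂ
        = ⟪HilbertTensor.tmul v' w', S (HilbertTensor.tmul v w)⟫_ℂ :=
      exists_clm_inner_eq_inner_comp (HilbertTensor.tmulL v) (HilbertTensor.tmulL.flip w') S
    obtain ⟨a, ha⟩ := hirr.exists_eq_smul hinv (A := A) fun g w => ext_inner_left ℂ fun v' => by
      rw [hAi, ← h₁, ← hAi, inner_apply_inv_left hinv]
    exact ⟨a, fun v' w => by rw [← hAi, ha, inner_smul_right]⟩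
  have hB : ∀ v' w, ∃ b : ℂ, ∀ w' v,
      ⟪HilbertTensor.tmul v' w', S (HilbertTensor.tmul v w)⟫_ℂ = b * ⟪w', v⟫_ℂ := by
    intro v' w
    obtain ⟨B, hBi⟩ : ∃ B : H →L[ℂ] H, ∀ w' v, ⟪w', B v⟫_ℂ
        = ⟪HilbertTensor.tmul v' w', S (HilbertTensor.tmul v w)⟫_ℂ :=
      exists_clm_inner_eq_inner_comp (HilbertTensor.tmulL.flip w) (HilbertTensor.tmulL v') S
    obtain ⟨b, hb⟩ := hirr.exists_eq_smul hinv (A := B) fun g v => ext_inner_left ℂ fun w' => by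
      rw [hBi, ← h₂, ← hBi, inner_apply_inv_left hinv]
    exact ⟨b, fun w' v => by rw [← hBi, hb, inner_smul_right]⟩
  choose a ha using hA
  choose b hb using hB
  have hb1 : b e e = 1 := by
    have := hb e e e e
    rwa [hS, hee, mul_one, eq_comm] at this
  refine HilbertTensor.clm_ext_inner fun v' w' v w => ?_
  have haw : a w' v = ⟪w', v⟫_ℂ := by
    have := ha w' v e e
    rwa [hb e e w' v, hee, hb1, one_mul, mul_one, eq_comm] at this
  rw [ha w' v, haw, HilbertTensor.flipOp_tmul', HilbertTensor.inner_tmul, mul_comm]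

end Intertwining

/-! ### Almost invariance of balls -/

section Annulus

variable {G : Type*} [MeasurableSpace G] {μ : Measure G} {L : G → ℝ}

/-- Since `σ` changes `L` by at most `d`, the symmetric difference of the ball and its image under
`σ` lies in the annulus between radii `n - d` and `n + d`. -/
lemma norm_setIntegral_comp_sub_le (hL : Measurable L) (σ : G ≃ᵐ G)
    (hσ : MeasurePreserving σ μ μ) (n d : ℝ) (hd : 0 ≤ d) (h₁ : ∀ g, L (σ g) ≤ L g + d)
    (h₂ : ∀ g, L g ≤ L (σ g) + d) (φ : G → ℂ) (hφ : IntegrableOn φ (lengthBall L (n + d)) μ) :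
    ‖∫ g in lengthBall L n, φ (σ g) ∂μ - ∫ g in lengthBall L n, φ g ∂μ‖
      ≤ ∫ g in lengthBall L (n + d) \ lengthBall L (n - d), ‖φ g‖ ∂μ := by
  have hball : ∀ r, MeasurableSet (lengthBall L r) := fun r =>
    measurableSet_le hL measurable_const
  set B := lengthBall L n with hB
  set C := σ.symm ⁻¹' B with hC
  have hCm : MeasurableSet C := σ.symm.measurable (hball n)
  have hCmem : ∀ g, g ∈ C ↔ L (σ.symm g) ≤ n := fun g => Iff.rfl
  have hBmem : ∀ g, g ∈ B ↔ L g ≤ n := fun g => Iff.rfl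
  have h₁' : ∀ g, L g ≤ L (σ.symm g) + d := fun g => by simpa using h₁ (σ.symm g)
  have h₂' : ∀ g, L (σ.symm g) ≤ L g + d := fun g => by simpa using h₂ (σ.symm g)
  have hCsub : C ⊆ lengthBall L (n + d) := fun g hg =>
    (h₁' g).trans (add_le_add_left ((hCmem g).mp hg) d)
  have hBsub : B ⊆ lengthBall L (n + d) := fun g hg =>
    ((hBmem g).mp hg).trans (le_add_of_nonneg_right hd)
  have hcomp : ∫ g in B, φ (σ g) ∂μ = ∫ g in C, φ g ∂μ := by
    rw [← hσ.setIntegral_preimage_emb σ.measurableEmbedding φ C]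
    congr 2
    ext g
    simp [hC]
  have hsub : (C \ B) ∪ (B \ C) ⊆ lengthBall L (n + d) \ lengthBall L (n - d) := by
    rintro g (⟨hgC, hgB⟩ | ⟨hgB, hgC⟩)
    · refine ⟨hCsub hgC, fun h => hgB ?_⟩
      have h' : L g ≤ n - d := h
      exact (hBmem g).mpr (by linarith)
    · refine ⟨hBsub hgB, fun h => hgC ?_⟩
      have h' : L g ≤ n - d := h
      exact (hCmem g).mpr (by linarith [h₂' g])
  have hφn : IntegrableOn (fun g => ‖φ g‖) (lengthBall L (n + d)) μ := hφ.norm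
  rw [hcomp, ← integral_inter_add_sdiff (hball n) (hφ.mono_set hCsub),
    ← integral_inter_add_sdiff hCm (hφ.mono_set hBsub), Set.inter_comm B C, add_sub_add_left_eq_sub]
  calc ‖∫ g in C \ B, φ g ∂μ - ∫ g in B \ C, φ g ∂μ‖
      ≤ ∫ g in C \ B, ‖φ g‖ ∂μ + ∫ g in B \ C, ‖φ g‖ ∂μ :=
        (norm_sub_le _ _).trans
          (add_le_add (norm_integral_le_integral_norm _) (norm_integral_le_integral_norm _))
    _ = ∫ g in (C \ B) ∪ (B \ C), ‖φ g‖ ∂μ :=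
        (setIntegral_union disjoint_sdiff_sdiff ((hball n).diff hCm)
          (hφn.mono_set (Set.sdiff_subset.trans hCsub))
          (hφn.mono_set (Set.sdiff_subset.trans hBsub))).symm
    _ ≤ _ := setIntegral_mono_set (hφn.mono_set Set.sdiff_subset)
        (ae_of_all _ fun g => norm_nonneg _) hsub.eventuallyLE

end Annulus

/-! ### Convergence of the ball averages -/

section Averages

set_option linter.unusedSectionVars false

variable {G : Type*} [Group G] [TopologicalSpace G] [IsTopologicalGroup G]
  [MeasurableSpace G] [BorelSpace G]
  {μ : Measure G} {X : Type*} [MeasurableSpace X] {ν : Measure X} [IsProbabilityMeasure ν]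
  [MulAction G X] [MeasurableConstSMul G X] {K : Subgroup G} {L : G → ℝ}

/-- The integral of `Ξ²` over a set. -/
noncomputable def sqMass (μ : Measure G) (ν : Measure X) (R : Set G) : ℝ :=
  ∫ g in R, harishChandra ν g ^ 2 ∂μ

lemma sqMass_nonneg (R : Set G) : 0 ≤ sqMass μ ν R :=
  integral_nonneg fun _ => sq_nonneg _

lemma integrableOn_harishChandra_sq (hν : PreservesMeasureClass G ν)
    (hcont : IsStronglyContinuous (koopman (G := G) hν)) {R : Set G} (hR : μ R < ∞) :
    IntegrableOn (fun g => harishChandra ν g ^ 2) R μ := by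
  have : Fact (μ R < ∞) := ⟨hR⟩
  refine Integrable.of_bound
    ((continuous_harishChandra hν hcont).pow 2).measurable.aestronglyMeasurable 1
    (ae_of_all _ fun g => ?_)
  rw [Real.norm_of_nonneg (sq_nonneg _)]
  exact pow_le_one₀ (harishChandra_pos hν g).le (harishChandra_le_one hν g)

lemma sqMass_pos (hν : PreservesMeasureClass G ν)
    (hcont : IsStronglyContinuous (koopman (G := G) hν)) {R : Set G} (hR : μ R < ∞)
    (hR0 : μ R ≠ 0) : 0 < sqMass μ ν R := by
  rw [sqMass, integral_pos_iff_support_of_nonneg (fun _ => sq_nonneg _)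
    (integrableOn_harishChandra_sq hν hcont hR)]
  have : (Function.support fun g : G => harishChandra ν g ^ 2) = Set.univ :=
    Set.eq_univ_of_forall fun g => (pow_pos (harishChandra_pos hν g) 2).ne'
  rw [this, Measure.restrict_apply_univ]
  exact pos_iff_ne_zero.mpr hR0

/-- This includes the degenerate case: if the denominator vanishes, its inverse is `0` and so is the
measure. -/
lemma integral_ballMeasure (n : ℕ) (f : G → ℂ) :
    ∫ g, f g ∂(ballMeasure μ ν L n)
      = (sqMass μ ν (lengthBall L n))⁻¹ • ∫ g in lengthBall L n, f g ∂μ := by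
  rw [ballMeasure, integral_smul_measure, ENNReal.toReal_ofReal]
  · rfl
  · exact inv_nonneg.mpr (sqMass_nonneg _)

lemma isFiniteMeasure_ballMeasure [IsFiniteMeasureOnCompacts μ] (hL : IsLengthFunction L)
    (ν : Measure X) (n : ℕ) : IsFiniteMeasure (ballMeasure μ ν L n) := by
  have : Fact (μ (lengthBall L n) < ∞) := ⟨hL.measure_lengthBall_lt_top μ n⟩
  exact Measure.smul_finite _ ENNReal.ofReal_ne_top

variable {hν : PreservesMeasureClass G ν}
  {M : ℕ → HilbertTensor (Lp ℂ 2 ν) →L[ℂ] HilbertTensor (Lp ℂ 2 ν)}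

lemma inner_average_eq
    (hM : ∀ n, IsOperatorIntegral (ballMeasure μ ν L n) (koopmanTensor hν) (M n)) (n : ℕ)
    (α β : HilbertTensor (Lp ℂ 2 ν)) :
    ⟪β, M n α⟫_ℂ = (sqMass μ ν (lengthBall L n))⁻¹ •
      ∫ g in lengthBall L n, ⟪β, koopmanTensor hν g α⟫_ℂ ∂μ := by
  rw [← (hM n α β).2, integral_ballMeasure]

lemma norm_average_le
    (hM : ∀ n, IsOperatorIntegral (ballMeasure μ ν L n) (koopmanTensor hν) (M n)) (n : ℕ)
    (hbd : ∀ α β, ∫ g in lengthBall L n, ‖⟪β, koopmanTensor hν g α⟫_ℂ‖ ∂μ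
      ≤ ‖α‖ * ‖β‖ * sqMass μ ν (lengthBall L n)) : ‖M n‖ ≤ 1 := by
  set D := sqMass μ ν (lengthBall L n)
  have hD : 0 ≤ D := sqMass_nonneg _
  refine ContinuousLinearMap.opNorm_le_bound _ zero_le_one fun α => ?_
  -- Testing against `β = M n α` gives `‖M n α‖² ≤ ‖α‖ ‖M n α‖`. A vanishing `D` is harmless, since
  -- only `D⁻¹ * D ≤ 1` is needed.
  have h : ‖⟪M n α, M n α⟫_ℂ‖ ≤ ‖α‖ * ‖M n α‖ := by
    rw [inner_average_eq hM, norm_smul, Real.norm_of_nonneg (inv_nonneg.mpr hD)]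
    calc D⁻¹ * ‖∫ g in lengthBall L n, ⟪M n α, koopmanTensor hν g α⟫_ℂ ∂μ‖
        ≤ D⁻¹ * (‖α‖ * ‖M n α‖ * D) :=
          mul_le_mul_of_nonneg_left ((norm_integral_le_integral_norm _).trans (hbd _ _))
            (inv_nonneg.mpr hD)
      _ = ‖α‖ * ‖M n α‖ * (D⁻¹ * D) := by ring
      _ ≤ ‖α‖ * ‖M n α‖ := mul_le_of_le_one_right (by positivity) inv_mul_le_one
  rw [inner_self_eq_norm_sq_to_K, norm_pow, RCLike.norm_ofReal, abs_norm, sq] at h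
  rw [one_mul]
  by_cases h0 : ‖M n α‖ = 0
  · rw [h0]; exact norm_nonneg _
  · exact le_of_mul_le_mul_right h (lt_of_le_of_ne (norm_nonneg _) (Ne.symm h0))

lemma tendsto_average_comp_sub [IsFiniteMeasureOnCompacts μ] (hL : IsLengthFunction L)
    (hcont : IsStronglyContinuous (koopman hν))
    (hbd : ∀ (s : Set ℝ), MeasurableSet s → μ (L ⁻¹' s) < ∞ → ∀ α β,
      ∫ g in L ⁻¹' s, ‖⟪β, koopmanTensor hν g α⟫_ℂ‖ ∂μ ≤ ‖α‖ * ‖β‖ * sqMass μ ν (L ⁻¹' s))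
    (hgrowth : ∀ n₀ : ℕ, 0 < n₀ → Tendsto (fun n : ℕ =>
      sqMass μ ν (lengthBall L ((n : ℝ) + n₀) \ lengthBall L ((n : ℝ) - n₀)) /
        sqMass μ ν (lengthBall L (n : ℝ))) atTop (𝓝 0))
    (σ : G ≃ᵐ G) (hσ : MeasurePreserving σ μ μ) (h : G) (h₁ : ∀ g, L (σ g) ≤ L g + L h)
    (h₂ : ∀ g, L g ≤ L (σ g) + L h) (α β : HilbertTensor (Lp ℂ 2 ν)) :
    Tendsto (fun n : ℕ => (sqMass μ ν (lengthBall L n))⁻¹ •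
        ∫ g in lengthBall L n, ⟪β, koopmanTensor hν (σ g) α⟫_ℂ ∂μ
      - (sqMass μ ν (lengthBall L n))⁻¹ •
        ∫ g in lengthBall L n, ⟪β, koopmanTensor hν g α⟫_ℂ ∂μ) atTop (𝓝 0) := by
  obtain ⟨d, hd⟩ := exists_nat_ge (L h)
  -- The width is `d + 1` because the growth hypothesis requires a positive integer and `d` may be
  -- `0`.
  have hd' : L h ≤ ((d + 1 : ℕ) : ℝ) := by push_cast; linarith
  have hlim := (hgrowth (d + 1) d.succ_pos).const_mul (‖α‖ * ‖β‖)
  rw [mul_zero] at hlim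
  refine squeeze_zero_norm (fun n => ?_) hlim
  rw [← smul_sub, norm_smul, Real.norm_of_nonneg (inv_nonneg.mpr (sqMass_nonneg _)),
    div_eq_inv_mul, mul_left_comm]
  refine mul_le_mul_of_nonneg_left ?_ (inv_nonneg.mpr (sqMass_nonneg _))
  have : Fact (μ (lengthBall L ((n : ℝ) + (d + 1 : ℕ))) < ∞) :=
    ⟨hL.measure_lengthBall_lt_top μ _⟩
  refine (norm_setIntegral_comp_sub_le hL.measurable σ hσ n (d + 1 : ℕ) (Nat.cast_nonneg _)
    (fun g => (h₁ g).trans (by gcongr)) (fun g => (h₂ g).trans (by gcongr)) _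
    (integrable_inner_koopmanTensor hν hcont α β _)).trans ?_
  have hpre : lengthBall L ((n : ℝ) + (d + 1 : ℕ)) \ lengthBall L ((n : ℝ) - (d + 1 : ℕ))
      = L ⁻¹' (Set.Iic ((n : ℝ) + (d + 1 : ℕ)) \ Set.Iic ((n : ℝ) - (d + 1 : ℕ))) := rfl
  rw [hpre]
  refine hbd _ (measurableSet_Iic.diff measurableSet_Iic) ?_ α β
  rw [← hpre]
  exact (measure_mono Set.sdiff_subset).trans_lt (hL.measure_lengthBall_lt_top μ _)

/-- Bounded averages of `π(g) ⊗ π(g⁻¹)` over balls converge weakly to the flip. -/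
lemma tendsto_inner_average [IsFiniteMeasureOnCompacts μ] [μ.IsOpenPosMeasure]
    [μ.IsMulLeftInvariant] [μ.IsMulRightInvariant] (hL : IsLengthFunction L)
    (hcont : IsStronglyContinuous (koopman hν)) (hirr : IsIrreducibleRep (koopman hν))
    (hbd : ∀ (s : Set ℝ), MeasurableSet s → μ (L ⁻¹' s) < ∞ → ∀ α β,
      ∫ g in L ⁻¹' s, ‖⟪β, koopmanTensor hν g α⟫_ℂ‖ ∂μ ≤ ‖α‖ * ‖β‖ * sqMass μ ν (L ⁻¹' s))
    (hgrowth : ∀ n₀ : ℕ, 0 < n₀ → Tendsto (fun n : ℕ =>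
      sqMass μ ν (lengthBall L ((n : ℝ) + n₀) \ lengthBall L ((n : ℝ) - n₀)) /
        sqMass μ ν (lengthBall L (n : ℝ))) atTop (𝓝 0))
    (hM : ∀ n, IsOperatorIntegral (ballMeasure μ ν L n) (koopmanTensor hν) (M n))
    (α β : HilbertTensor (Lp ℂ 2 ν)) :
    Tendsto (fun n => ⟪β, M n α⟫_ℂ) atTop (𝓝 ⟪β, flipOp (Lp ℂ 2 ν) α⟫_ℂ) := by
  have hnorm : ∀ n, ‖M n‖ ≤ 1 := fun n => norm_average_le hM n fun α β =>
    hbd (Set.Iic n) measurableSet_Iic (hL.measure_lengthBall_lt_top μ n) α β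
  -- Convergence may be tested along ultrafilters finer than `atTop`. Along each of them the
  -- averages have a weak limit `S`, and it remains to identify `S`.
  rw [tendsto_iff_ultrafilter]
  intro 𝒰 h𝒰
  obtain ⟨S, hS⟩ := exists_ultrafilter_limit 𝒰 M 1 hnorm
  suffices h : S = flipOp (Lp ℂ 2 ν) by rw [← h]; exact hS β α
  have huniq : ∀ α β α' β', Tendsto (fun n => ⟪β, M n α⟫_ℂ - ⟪β', M n α'⟫_ℂ) atTop (𝓝 0) →
      ⟪β, S α⟫_ℂ = ⟪β', S α'⟫_ℂ := fun α β α' β' h0 =>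
    sub_eq_zero.mp (tendsto_nhds_unique ((hS β α).sub (hS β' α')) (h0.mono_left h𝒰))
  refine hirr.eq_flipOp (koopman_apply_inv hν) S ?_ ?_ (oneVec ν) norm_oneVec ?_
  · intro h v' w' v w
    refine huniq _ _ _ _ ?_
    -- Substituting `hg` for `g`: `π(hg) v ⊗ π((hg)⁻¹) π(h) w = π(h) π(g) v ⊗ π(g⁻¹) w`.
    have := tendsto_average_comp_sub hL hcont hbd hgrowth (MeasurableEquiv.mulLeft h)
      (measurePreserving_mul_left μ h) h (fun g => (hL.map_mul_le h g).trans_eq (add_comm _ _))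
      (fun g => ?_) (HilbertTensor.tmul v (koopman hν h w)) (HilbertTensor.tmul v' w')
    · refine this.congr fun n => ?_
      rw [inner_average_eq hM, inner_average_eq hM]
      congr 3 with g
      rw [MeasurableEquiv.coe_mulLeft, inner_tmul_koopmanTensor, inner_tmul_koopmanTensor,
        inner_koopman_left, inv_inv, koopman_mul, mul_inv_rev, ← koopman_mul hν _ h,
        inv_mul_cancel_right]
    · have := hL.map_mul_le h⁻¹ (h * g)
      rw [inv_mul_cancel_left, hL.map_inv, add_comm] at this
      exact this
  · intro h v' w' v w
    refine huniq _ _ _ _ ?_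
    -- Substituting `gh⁻¹` for `g`: `π(gh⁻¹) π(h) v ⊗ π(hg⁻¹) w = π(g) v ⊗ π(h) π(g⁻¹) w`.
    have := tendsto_average_comp_sub hL hcont hbd hgrowth (MeasurableEquiv.mulRight h⁻¹)
      (measurePreserving_mul_right μ h⁻¹) h
      (fun g => (hL.map_mul_le g h⁻¹).trans_eq (by rw [hL.map_inv]))
      (fun g => ?_) (HilbertTensor.tmul (koopman hν h v) w) (HilbertTensor.tmul v' w')
    · refine this.congr fun n => ?_
      rw [inner_average_eq hM, inner_average_eq hM]
      congr 3 with g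
      rw [MeasurableEquiv.coe_mulRight, inner_tmul_koopmanTensor, inner_tmul_koopmanTensor,
        inner_koopman_left, inv_inv, mul_inv_rev, inv_inv, koopman_mul hν h g⁻¹,
        ← koopman_mul hν _ h, inv_mul_cancel_right]
    · have := hL.map_mul_le (g * h⁻¹) h
      rw [inv_mul_cancel_right] at this
      exact this
  -- The coefficient at `1 ⊗ 1` is `∫ Ξ² / ∫ Ξ² = 1` as soon as the ball has positive measure.
  · refine tendsto_nhds_unique (hS _ _) (Tendsto.mono_left ?_ h𝒰)
    obtain ⟨n₀, hn₀⟩ := exists_measure_inter_lengthBall_pos L μ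
      (isOpen_univ.measure_pos μ Set.univ_nonempty).ne'
    rw [Set.univ_inter] at hn₀
    refine tendsto_const_nhds.congr' ?_
    filter_upwards [eventually_ge_atTop n₀] with n hn
    have hsub : lengthBall L n₀ ⊆ lengthBall L n := fun g hg => by
      have h1 : L g ≤ n₀ := hg
      exact h1.trans (Nat.cast_le.mpr hn)
    have hpos : 0 < sqMass μ ν (lengthBall L n) :=
      sqMass_pos hν hcont (hL.measure_lengthBall_lt_top μ n)
        fun h0 => hn₀ (measure_mono_null hsub h0)
    rw [inner_average_eq hM]
    simp only [inner_tmul_koopmanTensor, ← harishChandra_eq_inner, harishChandra_inv hν,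
      ← sq,
      ← Complex.ofReal_pow]
    rw [integral_complex_ofReal, ← sqMass, Complex.real_smul, ← Complex.ofReal_mul,
      inv_mul_cancel₀ hpos.ne', Complex.ofReal_one]

end Averages

theorem corollary6p1
    {G : Type*} [Group G] [TopologicalSpace G] [IsTopologicalGroup G] [LocallyCompactSpace G]
    [T2Space G] [MeasurableSpace G] [BorelSpace G]
    -- a Haar measure, on a unimodular group
    (μ : Measure G) [μ.IsHaarMeasure] [μ.Regular] [μ.IsMulRightInvariant]
    -- a measurable action on a probability space, preserving the measure class
    {X : Type*} [MeasurableSpace X] (ν : Measure X) [IsProbabilityMeasure ν]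
    [MulAction G X] [MeasurableConstSMul G X]
    (hact : NullMeasurable (fun p : G × X => p.1 • p.2) (μ.prod ν))
    (hν : PreservesMeasureClass G ν)
    (hcont : IsStronglyContinuous (koopman (G := G) hν))
    -- a subgroup that acts transitively and preserves the measure
    (K : Subgroup G) (hKtrans : MulAction.IsPretransitive K X)
    (hKν : ∀ k ∈ K, MeasurePreserving (fun x : X => k • x) ν ν)
    -- a length function
    (L : G → ℝ) (hL : IsLengthFunction L) (hLK : IsBiInvariant K L)
    (hgrowth : ∀ n₀ : ℕ, 0 < n₀ →
      Tendsto (fun n : ℕ =>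
        (∫ g in lengthBall L ((n : ℝ) + n₀) \ lengthBall L ((n : ℝ) - n₀),
            harishChandra ν g ^ 2 ∂μ) /
          ∫ g in lengthBall L (n : ℝ), harishChandra ν g ^ 2 ∂μ) atTop (𝓝 0))
    (hirr : IsIrreducibleRep (koopman (G := G) hν)) :
    ∃ M : ℕ → (HilbertTensor (Lp ℂ 2 ν) →L[ℂ] HilbertTensor (Lp ℂ 2 ν)),
      (∀ n, IsOperatorIntegral (ballMeasure μ ν L n)
        (fun g => tensorOp (koopman hν g).toContinuousLinearMap
          (koopman hν g⁻¹).toContinuousLinearMap) (M n)) ∧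
      Tendsto (fun n => ContinuousLinearMapWOT.ofCLM (M n)) atTop
        (𝓝 (ContinuousLinearMapWOT.ofCLM (flipOp (Lp ℂ 2 ν)))) := by
  have hK1 : ∀ k ∈ K, koopman hν k (oneVec ν) = oneVec ν := fun k hk =>
    koopman_oneVec_of_measurePreserving hν (hKν k hk)
  have hK : ∀ v, (∀ k ∈ K, koopman hν k v = v) → ∃ c : ℂ, v = c • oneVec ν := fun v hv =>
    eq_smul_oneVec_of_koopman_eq hact hν hcont hKtrans hKν hL hLK hv
  -- Preimages under `L` are `K`-bi-invariant, so a single bound covers both the balls and the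
  -- annuli.
  have hbd : ∀ (s : Set ℝ), MeasurableSet s → μ (L ⁻¹' s) < ∞ → ∀ α β,
      ∫ g in L ⁻¹' s, ‖⟪β, koopmanTensor hν g α⟫_ℂ‖ ∂μ ≤ ‖α‖ * ‖β‖ * sqMass μ ν (L ⁻¹' s) :=
    fun s _ hs α β => setIntegral_norm_inner_le hν hcont hs _ (fun A B hA hB =>
      setIntegral_indCoeff_mul hν hcont hK hK1 (hLK.isBiInvariantSet s) hs hA hB) α β
  have hfin := isFiniteMeasure_ballMeasure (μ := μ) hL ν
  choose M hM using fun n =>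
    exists_isOperatorIntegral_koopmanTensor hν hcont (ballMeasure μ ν L n)
  refine ⟨M, hM, ?_⟩
  rw [ContinuousLinearMapWOT.tendsto_iff_forall_inner_apply_tendsto]
  exact fun α β => tendsto_inner_average hL hcont hirr hbd hgrowth hM α β
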